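/- Consider equations $y'=(p(x)y+q(x))^4+r(x)y+s(x)$ with smooth coefficients and $p\neq0$, regarded as sections of the bundle $\pi:\mathbb R^5\to\mathbb R$, $(x,p,q,r,s)\mapsto x$. Let $G$ be the pseudogroup of local smooth transformations $x\mapsto f(x)$, $y\mapsto g(x)y+h(x)$, where $f$ is an orientation-preserving diffeomorphism onto its image ($f'>0$) and $g\ne0$, that carry one such equation to another (which forces $g>0$). $G$ acts on sections of $\pi$; since an equation determines $(p,q)$ only up to a common sign, the action is fixed by requiring that it preserve the sign of $p$. Put $$L_0=p,\qquad L_1=q'p-p'q+p^2s-pqr,$$ $$L_2=p(pq''-qp'')+6p'(p'q-pq')+p'p(9qr-4ps)-5rp^2q'-p^2qr'+p^3s'+4p^2r(qr-ps),$$ $$J=\frac{L_2}{|L_0|^{1/2}|L_1|^{7/4}},\qquad \nabla=\frac{|L_0|^{1/2}}{|L_1|^{3/4}}\frac{D}{Dx},$$ where $D/Dx$ is the total derivative, and call a point of a jet space regular if $L_0\ne0$ and $L_1\neq0$ there (for $0$-jets: if $L_0\ne0$). A differential invariant of order at most $k$ is a smooth function on the regular points of $J^k(\pi)$ that is constant along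 the orbits of the prolonged action of $G$. Theorem. The operator $\nabla$ is an invariant derivation, that is, it commutes with the prolonged action of $G$, and $\nabla^iJ$ is a differential invariant of order at most $i+2$ for every $i\ge0$. The algebra of differential invariants is generated by $J$ and $\nabla$: on each of the four parts of the set of regular points determined by the signs of $L_0$ and $L_1$, every differential invariant of order at most $k$ is a smooth function of $J,\nabla J,\dots,\nabla^{k-2}J$ (a constant if $k\le1$). The algebra of differential invariants separates regular orbits: for every $k$, two regular points of $J^k(\pi)$ at which all differential invariants of order at most $k$ take equal values lie on the same orbit. -/

import Mathlib

open scoped ContDiff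

namespace QuarticODE

/-- Points of the infinite jet space of sections `x ↦ (p, q, r, s)` of the trivial bundle
`ℝ⁵ → ℝ`. A point is `(x, u)`, where `u i n` is the `n`-th derivative coordinate of the `i`-th
component; the components `0, 1, 2, 3` are `p, q, r, s`. -/
abbrev JInf : Type := ℝ × (Fin 4 → ℕ → ℝ)

/-- Points of the space of `k`-jets of sections. -/
abbrev Jet (k : ℕ) : Type := ℝ × (Fin 4 → Fin (k + 1) → ℝ)

/-- The projection of infinite jets to `k`-jets. -/
def trunc (k : ℕ) (z : JInf) : Jet k := (z.1, fun i n => z.2 i n)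

/-- The infinite jet of a section at `x`. -/
noncomputable def jetInf (σ : ℝ → Fin 4 → ℝ) (x : ℝ) : JInf :=
  (x, fun i n => iteratedDeriv n (fun t => σ t i) x)

/-- The `k`-jet of a section at `x`. -/
noncomputable def jet (k : ℕ) (σ : ℝ → Fin 4 → ℝ) (x : ℝ) : Jet k := trunc k (jetInf σ x)

/-- The right-hand side of the equation `y' = (p y + q)⁴ + r y + s` with coefficients `σ`. -/
def rhs (σ : ℝ → Fin 4 → ℝ) (x y : ℝ) : ℝ := (σ x 0 * y + σ x 1) ^ 4 + σ x 2 * y + σ x 3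

/-- `(x, y) ↦ (f x, g x * y + h x)` is a local transformation over the open set `U`: the three
functions are smooth, `f` is an orientation preserving diffeomorphism onto its image, and `g`
does not vanish. -/
structure IsTransf (U : Set ℝ) (f g h : ℝ → ℝ) : Prop where
  isOpen : IsOpen U
  smooth_f : ContDiffOn ℝ ∞ f U
  smooth_g : ContDiffOn ℝ ∞ g U
  smooth_h : ContDiffOn ℝ ∞ h U
  injOn : Set.InjOn f U
  deriv_pos : ∀ x ∈ U, 0 < deriv f x
  g_ne : ∀ x ∈ U, g x ≠ 0

/-- The transformation `(x, y) ↦ (f x, g x * y + h x)` over `U` carries the equation with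
coefficients `σ` (over `U`) to the equation with coefficients `τ` (over `f '' U`): with
`x₁ = f x`, `y₁ = g x * y + h x`, the equation `dy/dx = rhs σ x y` becomes
`dy₁/dx₁ = rhs τ x₁ y₁`. The pair `(p, q)` is determined by the equation up to a common sign;
the action on sections is the continuous one, which keeps the sign of `p`
(in particular `p ≠ 0`). -/
structure Carries (U : Set ℝ) (f g h : ℝ → ℝ) (σ τ : ℝ → Fin 4 → ℝ) : Prop where
  transf : IsTransf U f g h
  smooth_source : ContDiffOn ℝ ∞ σ U
  smooth_target : ContDiffOn ℝ ∞ τ (f '' U)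
  sign : ∀ x ∈ U, 0 < σ x 0 * τ (f x) 0
  eqn : ∀ x ∈ U, ∀ y : ℝ,
    rhs τ (f x) (g x * y + h x) * deriv f x = deriv g x * y + g x * rhs σ x y + deriv h x

/-- Two `k`-jets lie on the same orbit of the prolonged action. -/
def SameOrbit (k : ℕ) (z w : Jet k) : Prop :=
  ∃ (U : Set ℝ) (f g h : ℝ → ℝ) (σ τ : ℝ → Fin 4 → ℝ) (x : ℝ),
    Carries U f g h σ τ ∧ x ∈ U ∧ z = jet k σ x ∧ w = jet k τ (f x)

/-- The relative invariant `L₀ = p`. -/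
def L₀ (z : JInf) : ℝ := z.2 0 0

/-- The relative invariant `L₁ = q' p - p' q + p² s - p q r`. -/
def L₁ (z : JInf) : ℝ :=
  let p := z.2 0; let q := z.2 1; let r := z.2 2; let s := z.2 3
  q 1 * p 0 - p 1 * q 0 + p 0 ^ 2 * s 0 - p 0 * q 0 * r 0

/-- The relative invariant `L₂ = p (p q'' - q p'') + 6 p' (p' q - p q') + p' p (9 q r - 4 p s)
- 5 r p² q' - p² q r' + p³ s' + 4 p² r (q r - p s)`. -/
def L₂ (z : JInf) : ℝ :=
  let p := z.2 0; let q := z.2 1; let r := z.2 2; let s := z.2 3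
  p 0 * (p 0 * q 2 - q 0 * p 2) + 6 * p 1 * (p 1 * q 0 - p 0 * q 1)
    + p 1 * p 0 * (9 * q 0 * r 0 - 4 * p 0 * s 0)
    - 5 * r 0 * p 0 ^ 2 * q 1 - p 0 ^ 2 * q 0 * r 1 + p 0 ^ 3 * s 1
    + 4 * p 0 ^ 2 * r 0 * (q 0 * r 0 - p 0 * s 0)

/-- Regular points: `L₀` and `L₁` do not vanish. -/
def Regular : Set JInf := {z | L₀ z ≠ 0 ∧ L₁ z ≠ 0}

/-- Regular points of the space of `k`-jets. -/
def RegularJet (k : ℕ) : Set (Jet k) := trunc k '' Regular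

/-- On regular points, `I` is a smooth function of the `k`-jet. -/
def IsSmoothOfOrder (k : ℕ) (I : JInf → ℝ) : Prop :=
  ∃ F : Jet k → ℝ, ContDiffOn ℝ ∞ F (RegularJet k) ∧ ∀ z ∈ Regular, I z = F (trunc k z)

/-- `I` is an (absolute) differential invariant of order at most `k` on regular points: a smooth
function of the `k`-jet which is constant along the orbits of the prolonged action. -/
def IsDiffInvariant (k : ℕ) (I : JInf → ℝ) : Prop :=
  IsSmoothOfOrder k I ∧
    ∀ z ∈ Regular, ∀ w ∈ Regular, SameOrbit k (trunc k z) (trunc k w) → I z = I w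

/-- The total derivative `D/Dx`: the derivative along the vector whose `x`-component is `1` and
whose component at the coordinate `u i n` is `u i (n + 1)`. -/
noncomputable def totalD (F : JInf → ℝ) (z : JInf) : ℝ :=
  lineDeriv ℝ F z ((1, fun i n => z.2 i (n + 1)) : JInf)

/-- The operator `A D/Dx` is an invariant derivation: `A` is a smooth function of finite order,
and the operator commutes with the pull-back of functions by every prolonged transformation.
At the jet of `σ` at `x`, the total derivative of the pull-back of `F` is the derivative at `x`
of the pull-back evaluated along `σ`, that is of `t ↦ F (jetInf τ (f t))`. -/
def IsInvariantDerivation (A : JInf → ℝ) : Prop :=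
  (∃ m, IsSmoothOfOrder m A) ∧
    ∀ (k : ℕ) (F : JInf → ℝ), IsSmoothOfOrder k F →
      ∀ (U : Set ℝ) (f g h : ℝ → ℝ) (σ τ : ℝ → Fin 4 → ℝ), Carries U f g h σ τ →
        ∀ x ∈ U, jetInf σ x ∈ Regular →
          A (jetInf σ x) * deriv (fun t => F (jetInf τ (f t))) x
            = A (jetInf τ (f x)) * totalD F (jetInf τ (f x))

/-- The absolute invariant `J = L₂ / (|L₀|^{1/2} |L₁|^{7/4})`. -/
noncomputable def J (z : JInf) : ℝ :=
  L₂ z / (|L₀ z| ^ (1 / 2 : ℝ) * |L₁ z| ^ (7 / 4 : ℝ))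

/-- The coefficient `|L₀|^{1/2} / |L₁|^{3/4}` of the invariant derivation. -/
noncomputable def nablaCoeff (z : JInf) : ℝ := |L₀ z| ^ (1 / 2 : ℝ) / |L₁ z| ^ (3 / 4 : ℝ)

/-- The derivation `∇ = |L₀|^{1/2} / |L₁|^{3/4} D/Dx`. -/
noncomputable def nabla (F : JInf → ℝ) (z : JInf) : ℝ := nablaCoeff z * totalD F z

end QuarticODE

open QuarticODE

namespace QuarticODE

open Filter Topology

/-! Comparing powers of y, a transformation carries one equation to another exactly when four
relations hold (`rhs_relations`, `rhs_eqn_of_relations`): P⁴g³f' = p⁴, a relation matching the roots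
of py + q and Py + Q, and two relations that determine g' and h'. Differentiating the second and
eliminating g' and h' shows that L₁ is multiplied by P⁶g⁴/p⁶. Differentiating that law in turn gives
the factor P¹¹g⁷/p¹¹ for L₂, a corrected total derivative of L₁. In J all factors cancel. In the
coefficient of ∇ exactly f' survives, which makes ∇ invariant.

Normalizing the parameter, |p|, q/p and L₁ leaves y' = (ay)⁴ + r(x)y + b with a, b = ±1. There ∇ is
d/dx and ∇ⁱJ = -4ab r⁽ⁱ⁾ (`nabla_iterate_J_normalJet`), so the values of the ∇ⁱJ are free
coordinates. An invariant is thus its own restriction to normal jets, once each regular jet is known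
to share an orbit with a normal one.

Equality of orbits is proved by comparing two sections σ and ρ directly. Matching their canonical
parameters gives f, matching the normalizing factors gives g, and matching q/p gives h. The image of
σ is then ρ with r and s perturbed by multiples of the difference of the two J's
(`carries_adapted`). If the ∇ⁱJ agree for i ≤ k, this difference is flat to order k at the point,
and the image has the k-jet of ρ (`trunc_jetInf_adapted`). A k-jet controls only i ≤ k - 2. The two
missing equalities are arranged by prolonging suitably, since ∇ⁱJ is affine in q⁽ⁱ⁺²⁾ with nonzero
slope (`exists_prolongation`). -/

/-- The jet which agrees with `w` up to order `k` and with `z` in higher orders. -/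
def splice (k : ℕ) (w : Jet k) (z : JInf) : JInf :=
  (w.1, fun i n => if h : n < k + 1 then w.2 i ⟨n, h⟩ else z.2 i n)

theorem trunc_splice (k : ℕ) (w : Jet k) (z : JInf) : trunc k (splice k w z) = w := by
  ext
  · rfl
  · simp only [trunc, splice, Fin.is_lt, dite_true]

theorem splice_trunc (k : ℕ) (z : JInf) : splice k (trunc k z) z = z := by
  ext
  · rfl
  · simp [trunc, splice]

theorem continuous_splice (k : ℕ) (z : JInf) : Continuous fun w => splice k w z := by
  unfold splice
  refine Continuous.prodMk continuous_fst (continuous_pi fun i => continuous_pi fun n => ?_)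
  split_ifs
  · fun_prop
  · fun_prop

/-- Through every infinite jet passes the continuous section `splice` of the projection. Openness of
`RegularJet k` follows, so smoothness on it yields genuine derivatives. -/
theorem isOpenMap_trunc (k : ℕ) : IsOpenMap (trunc k) :=
  IsOpenMap.of_sections fun z =>
    ⟨fun w => splice k w z, (continuous_splice k z).continuousAt, splice_trunc k z,
      fun w => trunc_splice k w z⟩

theorem continuous_L₁ : Continuous L₁ := by
  unfold L₁
  fun_prop

theorem isOpen_regular : IsOpen Regular := by
  have h₀ : Continuous L₀ := by unfold L₀; fun_prop
  exact (isOpen_ne_fun h₀ continuous_const).inter (isOpen_ne_fun continuous_L₁ continuous_const)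

theorem isOpen_regularJet (k : ℕ) : IsOpen (RegularJet k) := isOpenMap_trunc k _ isOpen_regular

theorem trunc_mem {k : ℕ} {z : JInf} (hz : z ∈ Regular) : trunc k z ∈ RegularJet k :=
  Set.mem_image_of_mem _ hz

/-! ### Closure properties of smooth functions of finite order -/

namespace IsSmoothOfOrder

variable {k : ℕ} {I I' : JInf → ℝ}

theorem congr (hI : IsSmoothOfOrder k I) (h : ∀ z ∈ Regular, I' z = I z) :
    IsSmoothOfOrder k I' := by
  obtain ⟨F, hF, hIF⟩ := hI
  exact ⟨F, hF, fun z hz => (h z hz).trans (hIF z hz)⟩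

theorem const (k : ℕ) (c : ℝ) : IsSmoothOfOrder k fun _ => c :=
  ⟨fun _ => c, contDiffOn_const, fun _ _ => rfl⟩

theorem coord {k n : ℕ} (i : Fin 4) (h : n ≤ k) : IsSmoothOfOrder k fun z => z.2 i n :=
  ⟨fun w => w.2 i ⟨n, Nat.lt_succ_of_le h⟩, by fun_prop, fun _ _ => rfl⟩

theorem add (hI : IsSmoothOfOrder k I) (hI' : IsSmoothOfOrder k I') :
    IsSmoothOfOrder k fun z => I z + I' z := by
  obtain ⟨F, hF, h⟩ := hI
  obtain ⟨F', hF', h'⟩ := hI'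
  exact ⟨fun w => F w + F' w, hF.add hF', fun z hz => by simp only [h z hz, h' z hz]⟩

theorem mul (hI : IsSmoothOfOrder k I) (hI' : IsSmoothOfOrder k I') :
    IsSmoothOfOrder k fun z => I z * I' z := by
  obtain ⟨F, hF, h⟩ := hI
  obtain ⟨F', hF', h'⟩ := hI'
  exact ⟨fun w => F w * F' w, hF.mul hF', fun z hz => by simp only [h z hz, h' z hz]⟩

theorem sub (hI : IsSmoothOfOrder k I) (hI' : IsSmoothOfOrder k I') :
    IsSmoothOfOrder k fun z => I z - I' z := by
  obtain ⟨F, hF, h⟩ := hI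
  obtain ⟨F', hF', h'⟩ := hI'
  exact ⟨fun w => F w - F' w, hF.sub hF', fun z hz => by simp only [h z hz, h' z hz]⟩

theorem div (hI : IsSmoothOfOrder k I) (hI' : IsSmoothOfOrder k I')
    (h0 : ∀ z ∈ Regular, I' z ≠ 0) : IsSmoothOfOrder k fun z => I z / I' z := by
  obtain ⟨F, hF, h⟩ := hI
  obtain ⟨F', hF', h'⟩ := hI'
  refine ⟨fun w => F w / F' w, hF.div hF' ?_, fun z hz => by simp only [h z hz, h' z hz]⟩
  rintro _ ⟨z, hz, rfl⟩
  rw [← h' z hz]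
  exact h0 z hz

theorem abs (hI : IsSmoothOfOrder k I) (h0 : ∀ z ∈ Regular, I z ≠ 0) :
    IsSmoothOfOrder k fun z => |I z| := by
  obtain ⟨F, hF, h⟩ := hI
  refine ⟨fun w => |F w|, ?_, fun z hz => by simp only [h z hz]⟩
  rintro _ ⟨z, hz, rfl⟩
  exact (contDiffAt_abs (by rw [← h z hz]; exact h0 z hz)).comp_contDiffWithinAt _
    (hF _ (trunc_mem hz))

theorem rpow (hI : IsSmoothOfOrder k I) (h0 : ∀ z ∈ Regular, I z ≠ 0) (a : ℝ) :
    IsSmoothOfOrder k fun z => I z ^ a := by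
  obtain ⟨F, hF, h⟩ := hI
  refine ⟨fun w => F w ^ a, ?_, fun z hz => by simp only [h z hz]⟩
  refine hF.rpow_const_of_ne ?_
  rintro _ ⟨z, hz, rfl⟩
  rw [← h z hz]
  exact h0 z hz

theorem mono {l : ℕ} (hI : IsSmoothOfOrder k I) (hkl : k ≤ l) : IsSmoothOfOrder l I := by
  obtain ⟨F, hF, h⟩ := hI
  refine ⟨fun w => F (w.1, fun i n => w.2 i (Fin.castLE (by omega) n)), ?_, fun z hz => h z hz⟩
  refine hF.comp (ContDiff.contDiffOn (by fun_prop)) ?_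
  rintro _ ⟨z, hz, rfl⟩
  exact ⟨z, hz, rfl⟩

end IsSmoothOfOrder

/-! ### Orders of the relative invariants, of J and of ∇ -/

theorem isSmoothOfOrder_L₀ (k : ℕ) : IsSmoothOfOrder k L₀ := .coord 0 (Nat.zero_le k)

theorem isSmoothOfOrder_L₁ : IsSmoothOfOrder 1 L₁ := by
  have c (i : Fin 4) : IsSmoothOfOrder 1 fun z => z.2 i 0 := .coord i (by norm_num)
  have d (i : Fin 4) : IsSmoothOfOrder 1 fun z => z.2 i 1 := .coord i le_rfl
  refine (((((d 1).mul (c 0)).sub ((d 0).mul (c 1))).add (((c 0).mul (c 0)).mul (c 3))).sub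
    (((c 0).mul (c 1)).mul (c 2))).congr fun z _ => ?_
  simp only [L₁]
  ring

/-- The total derivative of `L₁`. -/
def DL₁ (z : JInf) : ℝ :=
  let p := z.2 0; let q := z.2 1; let r := z.2 2; let s := z.2 3
  q 2 * p 0 - p 2 * q 0 + 2 * p 0 * p 1 * s 0 + p 0 ^ 2 * s 1
    - p 1 * q 0 * r 0 - p 0 * q 1 * r 0 - p 0 * q 0 * r 1

/-- In this form L₂ is a covariant derivative: 6p' offsets the derivative of the p⁶ in the weight of
L₁, and 4pr offsets that of g⁴, because g'/g = f'R - r. -/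
theorem L₂_eq (z : JInf) :
    L₂ z = z.2 0 0 * DL₁ z - (6 * z.2 0 1 + 4 * z.2 0 0 * z.2 2 0) * L₁ z := by
  simp only [L₂, L₁, DL₁]
  ring

theorem isSmoothOfOrder_L₂ : IsSmoothOfOrder 2 L₂ := by
  have c (i : Fin 4) : IsSmoothOfOrder 2 fun z => z.2 i 0 := .coord i (by norm_num)
  have d (i : Fin 4) : IsSmoothOfOrder 2 fun z => z.2 i 1 := .coord i (by norm_num)
  have e (i : Fin 4) : IsSmoothOfOrder 2 fun z => z.2 i 2 := .coord i (by norm_num)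
  have hD : IsSmoothOfOrder 2 DL₁ :=
    (((((((e 1).mul (c 0)).sub ((e 0).mul (c 1))).add
      ((((IsSmoothOfOrder.const 2 2).mul (c 0)).mul (d 0)).mul (c 3))).add
      (((c 0).mul (c 0)).mul (d 3))).sub (((d 0).mul (c 1)).mul (c 2))).sub
      (((c 0).mul (d 1)).mul (c 2))).sub (((c 0).mul (c 1)).mul (d 2)) |>.congr
      fun z _ => by simp only [DL₁]; ring
  exact ((c 0).mul hD).sub ((((IsSmoothOfOrder.const 2 6).mul (d 0)).add
    (((IsSmoothOfOrder.const 2 4).mul (c 0)).mul (c 2))).mul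
    (isSmoothOfOrder_L₁.mono (by norm_num))) |>.congr fun z _ => L₂_eq z

theorem isSmoothOfOrder_absPow {k : ℕ} {I : JInf → ℝ} (hI : IsSmoothOfOrder k I)
    (h0 : ∀ z ∈ Regular, I z ≠ 0) (a : ℝ) : IsSmoothOfOrder k fun z => |I z| ^ a :=
  (hI.abs h0).rpow (fun z hz => abs_ne_zero.2 (h0 z hz)) a

theorem absPow_L₀_ne {z : JInf} (hz : z ∈ Regular) (a : ℝ) : |L₀ z| ^ a ≠ 0 :=
  (Real.rpow_pos_of_pos (abs_pos.2 hz.1) a).ne'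

theorem absPow_L₁_ne {z : JInf} (hz : z ∈ Regular) (a : ℝ) : |L₁ z| ^ a ≠ 0 :=
  (Real.rpow_pos_of_pos (abs_pos.2 hz.2) a).ne'

theorem isSmoothOfOrder_nablaCoeff : IsSmoothOfOrder 1 nablaCoeff :=
  (isSmoothOfOrder_absPow (isSmoothOfOrder_L₀ 1) (fun _ hz => hz.1) _).div
    (isSmoothOfOrder_absPow isSmoothOfOrder_L₁ (fun _ hz => hz.2) _)
    fun _ hz => absPow_L₁_ne hz _

theorem nablaCoeff_pos {z : JInf} (hz : z ∈ Regular) : 0 < nablaCoeff z :=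
  div_pos (Real.rpow_pos_of_pos (abs_pos.2 hz.1) _) (Real.rpow_pos_of_pos (abs_pos.2 hz.2) _)

theorem isSmoothOfOrder_J : IsSmoothOfOrder 2 J :=
  isSmoothOfOrder_L₂.div
    ((isSmoothOfOrder_absPow (isSmoothOfOrder_L₀ 2) (fun _ hz => hz.1) _).mul
      (isSmoothOfOrder_absPow (isSmoothOfOrder_L₁.mono one_le_two) (fun _ hz => hz.2) _))
    fun _ hz => mul_ne_zero (absPow_L₀_ne hz _) (absPow_L₁_ne hz _)

/-! ### Total derivatives as derivatives along curves -/

/-- The direction of the total derivative at `z`. -/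
def totalVec (z : JInf) : JInf := (1, fun i n => z.2 i (n + 1))

/-- Only the velocity of the curve up to order k enters. This covers both the straight line that
defines `totalD` and the jets of a section, so the two derivatives agree. -/
theorem hasDerivAt_comp_aux {k : ℕ} {I : JInf → ℝ} {F : Jet k → ℝ}
    (hF : ContDiffOn ℝ ∞ F (RegularJet k)) (hIF : ∀ z ∈ Regular, I z = F (trunc k z))
    {γ : ℝ → JInf} {t : ℝ} (hγ : ∀ᶠ s in 𝓝 t, γ s ∈ Regular)
    (h₁ : HasDerivAt (fun s => (γ s).1) 1 t)
    (h₂ : ∀ i, ∀ n ≤ k, HasDerivAt (fun s => (γ s).2 i n) ((γ t).2 i (n + 1)) t) :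
    HasDerivAt (fun s => I (γ s)) (fderiv ℝ F (trunc k (γ t)) (trunc k (totalVec (γ t)))) t := by
  have hd : HasFDerivAt F (fderiv ℝ F (trunc k (γ t))) (trunc k (γ t)) :=
    ((hF.contDiffAt ((isOpen_regularJet k).mem_nhds (trunc_mem hγ.self_of_nhds))).differentiableAt
      (by simp)).hasFDerivAt
  have hv : HasDerivAt (fun s => trunc k (γ s)) (trunc k (totalVec (γ t))) t := by
    refine HasDerivAt.prodMk h₁ (hasDerivAt_pi.2 fun i => hasDerivAt_pi.2 fun n => ?_)
    exact h₂ i n (Nat.le_of_lt_succ n.2)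
  exact (hd.comp_hasDerivAt t hv).congr_of_eventuallyEq (hγ.mono fun s hs => hIF _ hs)

theorem eventually_line_mem {z : JInf} (hz : z ∈ Regular) (v : JInf) :
    ∀ᶠ s in 𝓝 (0 : ℝ), z + s • v ∈ Regular := by
  have hc : Continuous fun s : ℝ => z + s • v := by fun_prop
  exact hc.continuousAt.eventually_mem (isOpen_regular.mem_nhds (by simpa using hz))

theorem hasDerivAt_line_aux {k : ℕ} {I : JInf → ℝ} {F : Jet k → ℝ}
    (hF : ContDiffOn ℝ ∞ F (RegularJet k)) (hIF : ∀ z ∈ Regular, I z = F (trunc k z))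
    {z : JInf} (hz : z ∈ Regular) :
    HasDerivAt (fun s : ℝ => I (z + s • totalVec z))
      (fderiv ℝ F (trunc k z) (trunc k (totalVec z))) 0 := by
  have := hasDerivAt_comp_aux hF hIF (γ := fun s => z + s • totalVec z) (t := 0)
    (eventually_line_mem hz _)
    (by simpa [totalVec] using (hasDerivAt_id (0 : ℝ)).const_add z.1)
    (fun i n _ => by
      simpa [totalVec] using ((hasDerivAt_id (0 : ℝ)).mul_const (z.2 i (n + 1))).const_add (z.2 i n))
  simpa using this

theorem totalD_eq_fderiv {k : ℕ} {I : JInf → ℝ} {F : Jet k → ℝ}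
    (hF : ContDiffOn ℝ ∞ F (RegularJet k)) (hIF : ∀ z ∈ Regular, I z = F (trunc k z))
    {z : JInf} (hz : z ∈ Regular) :
    totalD I z = fderiv ℝ F (trunc k z) (trunc k (totalVec z)) :=
  (hasDerivAt_line_aux hF hIF hz).deriv

namespace IsSmoothOfOrder

variable {k : ℕ} {I : JInf → ℝ}

theorem hasDerivAt_line (hI : IsSmoothOfOrder k I) {z : JInf} (hz : z ∈ Regular) :
    HasDerivAt (fun s : ℝ => I (z + s • totalVec z)) (totalD I z) 0 := by
  obtain ⟨F, hF, hIF⟩ := hI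
  rw [totalD_eq_fderiv hF hIF hz]
  exact hasDerivAt_line_aux hF hIF hz

theorem hasDerivAt_comp (hI : IsSmoothOfOrder k I) {γ : ℝ → JInf} {t : ℝ}
    (hγ : ∀ᶠ s in 𝓝 t, γ s ∈ Regular) (h₁ : HasDerivAt (fun s => (γ s).1) 1 t)
    (h₂ : ∀ i, ∀ n ≤ k, HasDerivAt (fun s => (γ s).2 i n) ((γ t).2 i (n + 1)) t) :
    HasDerivAt (fun s => I (γ s)) (totalD I (γ t)) t := by
  obtain ⟨F, hF, hIF⟩ := hI
  rw [totalD_eq_fderiv hF hIF hγ.self_of_nhds]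
  exact hasDerivAt_comp_aux hF hIF hγ h₁ h₂

theorem totalD (hI : IsSmoothOfOrder k I) : IsSmoothOfOrder (k + 1) (totalD I) := by
  obtain ⟨F, hF, hIF⟩ := hI
  let a : Jet (k + 1) → Jet k := fun w => (w.1, fun i n => w.2 i n.castSucc)
  let b : Jet (k + 1) → Jet k := fun w => (1, fun i n => w.2 i n.succ)
  refine ⟨fun w => fderiv ℝ F (a w) (b w), ?_, fun z hz => totalD_eq_fderiv hF hIF hz⟩
  have ha : ContDiff ℝ ∞ a := by fun_prop
  have hb : ContDiff ℝ ∞ b := by fun_prop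
  have hmaps : Set.MapsTo a (RegularJet (k + 1)) (RegularJet k) := by
    rintro _ ⟨z, hz, rfl⟩
    exact ⟨z, hz, rfl⟩
  exact ((hF.fderiv_of_isOpen (isOpen_regularJet k) le_rfl).comp ha.contDiffOn hmaps).clm_apply
    hb.contDiffOn

theorem nabla (hI : IsSmoothOfOrder k I) : IsSmoothOfOrder (k + 1) (nabla I) :=
  (isSmoothOfOrder_nablaCoeff.mono (by omega)).mul hI.totalD

end IsSmoothOfOrder

theorem isSmoothOfOrder_nabla_iterate_J (i : ℕ) : IsSmoothOfOrder (i + 2) (nabla^[i] J) := by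
  induction i with
  | zero => exact isSmoothOfOrder_J
  | succ i ih =>
    rw [Function.iterate_succ_apply']
    exact ih.nabla

/-! ### Functions along sections -/

section Sections

variable {U : Set ℝ} {σ : ℝ → Fin 4 → ℝ}

theorem contDiffOn_iteratedDeriv (hU : IsOpen U) (hσ : ContDiffOn ℝ ∞ σ U) (i : Fin 4) (n : ℕ) :
    ContDiffOn ℝ ∞ (iteratedDeriv n fun t => σ t i) U := by
  have h := contDiffOn_pi.1 hσ i
  induction n with
  | zero => simpa using h
  | succ n ih =>
    rw [iteratedDeriv_succ]
    exact ih.deriv_of_isOpen hU le_rfl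

theorem hasDerivAt_iteratedDeriv (hU : IsOpen U) (hσ : ContDiffOn ℝ ∞ σ U) (i : Fin 4) (n : ℕ)
    {t : ℝ} (ht : t ∈ U) : HasDerivAt (iteratedDeriv n fun t => σ t i)
      (iteratedDeriv (n + 1) (fun t => σ t i) t) t := by
  rw [iteratedDeriv_succ]
  exact (((contDiffOn_iteratedDeriv hU hσ i n).contDiffAt (hU.mem_nhds ht)).differentiableAt
    (by simp)).hasDerivAt

theorem continuousOn_jetInf (hU : IsOpen U) (hσ : ContDiffOn ℝ ∞ σ U) :
    ContinuousOn (jetInf σ) U :=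
  continuousOn_id.prodMk <| continuousOn_pi.2 fun i => continuousOn_pi.2 fun n =>
    (contDiffOn_iteratedDeriv hU hσ i n).continuousOn

theorem eventually_jetInf_mem (hU : IsOpen U) (hσ : ContDiffOn ℝ ∞ σ U) {t : ℝ} (ht : t ∈ U)
    (hreg : jetInf σ t ∈ Regular) : ∀ᶠ s in 𝓝 t, jetInf σ s ∈ Regular :=
  ((continuousOn_jetInf hU hσ).continuousAt (hU.mem_nhds ht)).eventually_mem
    (isOpen_regular.mem_nhds hreg)

theorem hasDerivAt_along {k : ℕ} {I : JInf → ℝ} (hI : IsSmoothOfOrder k I) (hU : IsOpen U)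
    (hσ : ContDiffOn ℝ ∞ σ U) {t : ℝ} (ht : t ∈ U) (hreg : jetInf σ t ∈ Regular) :
    HasDerivAt (fun s => I (jetInf σ s)) (totalD I (jetInf σ t)) t :=
  hI.hasDerivAt_comp (eventually_jetInf_mem hU hσ ht hreg) (hasDerivAt_id t)
    fun i n _ => hasDerivAt_iteratedDeriv hU hσ i n ht

theorem contDiffOn_along {k : ℕ} {I : JInf → ℝ} (hI : IsSmoothOfOrder k I) (hU : IsOpen U)
    (hσ : ContDiffOn ℝ ∞ σ U) (hreg : ∀ t ∈ U, jetInf σ t ∈ Regular) :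
    ContDiffOn ℝ ∞ (fun s => I (jetInf σ s)) U := by
  obtain ⟨F, hF, hIF⟩ := hI
  have hj : ContDiffOn ℝ ∞ (fun s => trunc k (jetInf σ s)) U :=
    contDiffOn_id.prodMk <| contDiffOn_pi.2 fun i => contDiffOn_pi.2 fun n =>
      contDiffOn_iteratedDeriv hU hσ i n
  exact (hF.comp hj fun t ht => trunc_mem (hreg t ht)).congr fun t ht => hIF _ (hreg t ht)

end Sections

/-! ### Transformations -/

theorem rhs_relations {p q r s P Q R S g h f' g' h' : ℝ} (hf : 0 < f') (hg : g ≠ 0)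
    (hp : 0 < p * P)
    (E : ∀ y, ((P * (g * y + h) + Q) ^ 4 + R * (g * y + h) + S) * f'
      = g' * y + g * ((p * y + q) ^ 4 + r * y + s) + h') :
    0 < g ∧ P ^ 4 * g ^ 3 * f' = p ^ 4 ∧ p * (P * h + Q) = q * P * g ∧
      f' * R * g = g' + g * r ∧ f' * (R * h + S) = g * s + h' := by
  have hp0 : p ≠ 0 := left_ne_zero_of_mul hp.ne'
  have hP0 : P ≠ 0 := right_ne_zero_of_mul hp.ne'
  have E0 := E 0
  have E1 := E 1
  have E2 := E 2
  have E3 := E (-1)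
  have E4 := E (-2)
  -- The fourth central difference isolates the coefficient of y⁴; the third difference below
  -- isolates that of y³.
  have a4 : P ^ 4 * g ^ 3 * f' = p ^ 4 := by
    apply mul_left_cancel₀ hg
    linear_combination (E2 + E4 - 4 * E1 - 4 * E3 + 6 * E0) / 24
  have a3 : P ^ 3 * g ^ 2 * (P * h + Q) * f' = p ^ 3 * q := by
    apply mul_left_cancel₀ hg
    linear_combination (E2 - E4 - 2 * E1 + 2 * E3) / 48
  have hX : p * (P * h + Q) = q * P * g := by
    apply mul_left_cancel₀ (pow_ne_zero 4 hp0)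
    linear_combination p * g * P * a3 - p * (P * h + Q) * a4
  -- The linear forms are proportional, so the quartic terms cancel identically and only an affine
  -- identity in y remains.
  have key (y : ℝ) : (P * (g * y + h) + Q) ^ 4 * f' = g * (p * y + q) ^ 4 := by
    have e : p * (P * (g * y + h) + Q) = P * g * (p * y + q) := by linear_combination hX
    apply mul_left_cancel₀ (pow_ne_zero 4 hp0)
    calc p ^ 4 * ((P * (g * y + h) + Q) ^ 4 * f')
        = (p * (P * (g * y + h) + Q)) ^ 4 * f' := by ring
      _ = _ := by rw [e]; linear_combination g * (p * y + q) ^ 4 * a4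
  refine ⟨?_, a4, hX, ?_, ?_⟩
  · have : 0 < P ^ 4 * g ^ 3 * f' := by rw [a4]; positivity
    have h3 : 0 < P ^ 4 * g ^ 3 := pos_of_mul_pos_left this hf.le
    have h4 : 0 < g ^ 3 := pos_of_mul_pos_right h3 (by positivity)
    exact (Odd.pow_pos_iff (by decide)).1 h4
  · linear_combination E1 - E0 - key 1 + key 0
  · linear_combination E0 - key 0

theorem rhs_eqn_of_relations {p q r s P Q R S g h f' g' h' : ℝ} (hp0 : p ≠ 0)
    (a4 : P ^ 4 * g ^ 3 * f' = p ^ 4) (hX : p * (P * h + Q) = q * P * g)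
    (h1 : f' * R * g = g' + g * r) (h0 : f' * (R * h + S) = g * s + h') (y : ℝ) :
    ((P * (g * y + h) + Q) ^ 4 + R * (g * y + h) + S) * f'
      = g' * y + g * ((p * y + q) ^ 4 + r * y + s) + h' := by
  have key : (P * (g * y + h) + Q) ^ 4 * f' = g * (p * y + q) ^ 4 := by
    have e : p * (P * (g * y + h) + Q) = P * g * (p * y + q) := by linear_combination hX
    apply mul_left_cancel₀ (pow_ne_zero 4 hp0)
    calc p ^ 4 * ((P * (g * y + h) + Q) ^ 4 * f')
        = (p * (P * (g * y + h) + Q)) ^ 4 * f' := by ring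
      _ = _ := by rw [e]; linear_combination g * (p * y + q) ^ 4 * a4
  linear_combination key + y * h1 + h0

/-- Here `e1` is the derivative of `e3`; `e4` and `e5` eliminate g' and h', and `e0` finally removes
f'. -/
theorem L₁_relation {p q r s p' q' P Q R S P' Q' g h f' g' h' : ℝ} (hf : f' ≠ 0)
    (e0 : P ^ 4 * g ^ 3 * f' = p ^ 4) (e3 : p * (P * h + Q) = q * P * g)
    (e4 : f' * R * g = g' + g * r) (e5 : f' * (R * h + S) = g * s + h')
    (e1 : p' * (P * h + Q) + p * (P' * f' * h + P * h' + Q' * f')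
      = q' * (P * g) + q * (P' * f' * g + P * g')) :
    p ^ 6 * (Q' * P - P' * Q + P ^ 2 * S - P * Q * R)
      = P ^ 6 * g ^ 4 * (q' * p - p' * q + p ^ 2 * s - p * q * r) := by
  have : p ^ 2 * f' * (Q' * P - P' * Q + P ^ 2 * S - P * Q * R)
      = P ^ 2 * g * (q' * p - p' * q + p ^ 2 * s - p * q * r) := by
    linear_combination p * P * e1 + p ^ 2 * P ^ 2 * e5
      - (P * p' + p * f' * P' + p * P * f' * R) * e3 - p * P ^ 2 * q * e4
  apply mul_left_cancel₀ hf
  linear_combination p ^ 4 * this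
    - P ^ 2 * g * (q' * p - p' * q + p ^ 2 * s - p * q * r) * e0

/-- Here `e1` is the derivative of the law `e6` for L₁, and `e4` eliminates g'. -/
theorem L₂_relation {p r p' P R P' g f' g' L L' M M' : ℝ} (hf : f' ≠ 0)
    (e0 : P ^ 4 * g ^ 3 * f' = p ^ 4) (e4 : f' * R * g = g' + g * r)
    (e6 : p ^ 6 * M = P ^ 6 * g ^ 4 * L)
    (e1 : 6 * p ^ 5 * p' * M + p ^ 6 * (M' * f')
      = (6 * P ^ 5 * (P' * f') * g ^ 4 + P ^ 6 * (4 * g ^ 3 * g')) * L + P ^ 6 * g ^ 4 * L') :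
    p ^ 11 * (P * M' - (6 * P' + 4 * P * R) * M)
      = P ^ 11 * g ^ 7 * (p * L' - (6 * p' + 4 * p * r) * L) := by
  have : p ^ 7 * f' * (P * M' - (6 * P' + 4 * P * R) * M)
      = P ^ 7 * g ^ 4 * (p * L' - (6 * p' + 4 * p * r) * L) := by
    linear_combination p * P * e1 - (6 * P * p' + 6 * p * f' * P' + 4 * p * P * f' * R) * e6
      - 4 * p * P ^ 7 * g ^ 3 * L * e4
  apply mul_left_cancel₀ hf
  linear_combination p ^ 4 * this
    - P ^ 7 * g ^ 4 * (p * L' - (6 * p' + 4 * p * r) * L) * e0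

theorem IsTransf.hasDerivAt_f {U : Set ℝ} {f g h : ℝ → ℝ} (H : IsTransf U f g h) {x : ℝ}
    (hx : x ∈ U) : HasDerivAt f (deriv f x) x :=
  ((H.smooth_f.contDiffAt (H.isOpen.mem_nhds hx)).differentiableAt (by simp)).hasDerivAt

theorem isOpen_image_of_deriv_pos {U : Set ℝ} {f : ℝ → ℝ} (hU : IsOpen U)
    (hf : ContDiffOn ℝ ∞ f U) (h : ∀ x ∈ U, 0 < deriv f x) : IsOpen (f '' U) := by
  rw [isOpen_iff_mem_nhds]
  rintro _ ⟨x, hx, rfl⟩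
  have hs := (hf.contDiffAt (hU.mem_nhds hx)).hasStrictDerivAt (by simp)
  rw [← hs.map_nhds_eq (h x hx).ne']
  exact image_mem_map (hU.mem_nhds hx)

theorem hasDerivAt_section {U : Set ℝ} {σ : ℝ → Fin 4 → ℝ} (hU : IsOpen U)
    (hσ : ContDiffOn ℝ ∞ σ U) (i : Fin 4) {t : ℝ} (ht : t ∈ U) :
    HasDerivAt (fun t => σ t i) ((jetInf σ t).2 i 1) t := by
  simpa [jetInf] using hasDerivAt_iteratedDeriv hU hσ i 0 ht

theorem hasDerivAt_L₁ {U : Set ℝ} {σ : ℝ → Fin 4 → ℝ} (hU : IsOpen U)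
    (hσ : ContDiffOn ℝ ∞ σ U) {t : ℝ} (ht : t ∈ U) :
    HasDerivAt (fun t => L₁ (jetInf σ t)) (DL₁ (jetInf σ t)) t := by
  have d (i : Fin 4) (n : ℕ) : HasDerivAt (fun s => (jetInf σ s).2 i n)
      ((jetInf σ t).2 i (n + 1)) t := hasDerivAt_iteratedDeriv hU hσ i n ht
  refine (((((d 1 1).mul (d 0 0)).sub ((d 0 1).mul (d 1 0))).add
    (((d 0 0).pow 2).mul (d 3 0))).sub (((d 0 0).mul (d 1 0)).mul (d 2 0))).congr_deriv ?_
  simp only [DL₁, Pi.mul_apply, Pi.pow_apply]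
  push_cast
  ring

namespace Carries

variable {U : Set ℝ} {f g h : ℝ → ℝ} {σ τ : ℝ → Fin 4 → ℝ} {x : ℝ}

theorem isOpen (H : Carries U f g h σ τ) : IsOpen U := H.transf.isOpen

theorem isOpen_image (H : Carries U f g h σ τ) : IsOpen (f '' U) :=
  isOpen_image_of_deriv_pos H.isOpen H.transf.smooth_f H.transf.deriv_pos

theorem relations (H : Carries U f g h σ τ) (hx : x ∈ U) :
    0 < g x ∧ τ (f x) 0 ^ 4 * g x ^ 3 * deriv f x = σ x 0 ^ 4 ∧
      σ x 0 * (τ (f x) 0 * h x + τ (f x) 1) = σ x 1 * τ (f x) 0 * g x ∧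
      deriv f x * τ (f x) 2 * g x = deriv g x + g x * σ x 2 ∧
      deriv f x * (τ (f x) 2 * h x + τ (f x) 3) = g x * σ x 3 + deriv h x :=
  rhs_relations (H.transf.deriv_pos x hx) (H.transf.g_ne x hx) (H.sign x hx) (H.eqn x hx)

theorem target_ne (H : Carries U f g h σ τ) (hx : x ∈ U) : τ (f x) 0 ≠ 0 :=
  right_ne_zero_of_mul (H.sign x hx).ne'

theorem source_ne (H : Carries U f g h σ τ) (hx : x ∈ U) : σ x 0 ≠ 0 :=
  left_ne_zero_of_mul (H.sign x hx).ne'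

theorem hasDerivAt_target (H : Carries U f g h σ τ) (hx : x ∈ U) (i : Fin 4) :
    HasDerivAt (fun t => τ (f t) i) ((jetInf τ (f x)).2 i 1 * deriv f x) x :=
  (hasDerivAt_section H.isOpen_image H.smooth_target i (Set.mem_image_of_mem f hx)).comp x
    (H.transf.hasDerivAt_f hx)

theorem L₁_eq (H : Carries U f g h σ τ) (hx : x ∈ U) :
    σ x 0 ^ 6 * L₁ (jetInf τ (f x)) = τ (f x) 0 ^ 6 * g x ^ 4 * L₁ (jetInf σ x) := by
  obtain ⟨-, e0, e3, e4, e5⟩ := H.relations hx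
  have hσ (i : Fin 4) := hasDerivAt_section H.isOpen H.smooth_source i hx
  have hτ (i : Fin 4) := H.hasDerivAt_target hx i
  have hg : HasDerivAt g (deriv g x) x :=
    ((H.transf.smooth_g.contDiffAt (H.isOpen.mem_nhds hx)).differentiableAt (by simp)).hasDerivAt
  have hh : HasDerivAt h (deriv h x) x :=
    ((H.transf.smooth_h.contDiffAt (H.isOpen.mem_nhds hx)).differentiableAt (by simp)).hasDerivAt
  have d1 := (hσ 0).mul (((hτ 0).mul hh).add (hτ 1))
  have d2 := ((hσ 1).mul (hτ 0)).mul hg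
  have e1 := d1.unique (d2.congr_of_eventuallyEq <| by
    filter_upwards [H.isOpen.mem_nhds hx] with t ht using (H.relations ht).2.2.1)
  have := L₁_relation (H.transf.deriv_pos x hx).ne' e0 e3 e4 e5
    (p' := (jetInf σ x).2 0 1) (q' := (jetInf σ x).2 1 1)
    (P' := (jetInf τ (f x)).2 0 1) (Q' := (jetInf τ (f x)).2 1 1) (by
      simp only [Pi.mul_apply, Pi.add_apply] at e1
      linear_combination e1)
  simpa [L₁, jetInf] using this

theorem L₂_eq (H : Carries U f g h σ τ) (hx : x ∈ U) :
    σ x 0 ^ 11 * L₂ (jetInf τ (f x)) = τ (f x) 0 ^ 11 * g x ^ 7 * L₂ (jetInf σ x) := by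
  obtain ⟨-, e0, -, e4, -⟩ := H.relations hx
  have hσ := hasDerivAt_section H.isOpen H.smooth_source 0 hx
  have hτ := H.hasDerivAt_target hx 0
  have hg : HasDerivAt g (deriv g x) x :=
    ((H.transf.smooth_g.contDiffAt (H.isOpen.mem_nhds hx)).differentiableAt (by simp)).hasDerivAt
  have hL := hasDerivAt_L₁ H.isOpen H.smooth_source hx
  have hM : HasDerivAt (fun t => L₁ (jetInf τ (f t))) (DL₁ (jetInf τ (f x)) * deriv f x) x :=
    (hasDerivAt_L₁ H.isOpen_image H.smooth_target (Set.mem_image_of_mem f hx)).comp x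
      (H.transf.hasDerivAt_f hx)
  have d1 := (hσ.pow 6).mul hM
  have d2 := ((hτ.pow 6).mul (hg.pow 4)).mul hL
  have e1 := d1.unique (d2.congr_of_eventuallyEq <| by
    filter_upwards [H.isOpen.mem_nhds hx] with t ht using H.L₁_eq ht)
  have := L₂_relation (H.transf.deriv_pos x hx).ne' e0 e4 (H.L₁_eq hx)
    (p' := (jetInf σ x).2 0 1) (P' := (jetInf τ (f x)).2 0 1)
    (L' := DL₁ (jetInf σ x)) (M' := DL₁ (jetInf τ (f x))) (by
      simp only [Pi.mul_apply, Pi.pow_apply] at e1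
      push_cast at e1
      linear_combination e1)
  rw [QuarticODE.L₂_eq, QuarticODE.L₂_eq]
  simpa [jetInf] using this

theorem regular (H : Carries U f g h σ τ) (hx : x ∈ U) (hr : jetInf σ x ∈ Regular) :
    jetInf τ (f x) ∈ Regular := by
  refine ⟨by simpa [L₀, jetInf] using H.target_ne hx, fun h0 => ?_⟩
  have := H.L₁_eq hx
  rw [h0, mul_zero] at this
  exact mul_ne_zero (mul_ne_zero (pow_ne_zero 6 (H.target_ne hx))
    (pow_ne_zero 4 (H.transf.g_ne x hx))) hr.2 this.symm

end Carries

/-! ### Invariance of J and ∇ -/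

theorem exists_fourth_root {x : ℝ} (hx : x ≠ 0) : ∃ u : ℝ, 0 < u ∧ |x| = u ^ 4 ∧
    |x| ^ (1 / 2 : ℝ) = u ^ 2 ∧ |x| ^ (3 / 4 : ℝ) = u ^ 3 ∧ |x| ^ (7 / 4 : ℝ) = u ^ 7 ∧
    |x| ^ (1 / 4 : ℝ) = u ^ 1 ∧ |x| ^ (3 / 2 : ℝ) = u ^ 6 := by
  have h := abs_pos.2 hx
  refine ⟨|x| ^ (1 / 4 : ℝ), Real.rpow_pos_of_pos h _, ?_, ?_, ?_, ?_, ?_, ?_⟩ <;>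
    rw [← Real.rpow_natCast, ← Real.rpow_mul h.le] <;> norm_num

/-- In terms of positive fourth roots of |p|, |P|, |L|, |M| every fractional power is a monomial,
and both claims become rational identities. -/
theorem abs_relations {p P L M g f' : ℝ} (hpP : 0 < p * P) (hL : L ≠ 0) (hM : M ≠ 0)
    (hg : 0 < g) (e0 : P ^ 4 * g ^ 3 * f' = p ^ 4) (e6 : p ^ 6 * M = P ^ 6 * g ^ 4 * L) :
    |P| ^ (1 / 2 : ℝ) / |M| ^ (3 / 4 : ℝ) = f' * (|p| ^ (1 / 2 : ℝ) / |L| ^ (3 / 4 : ℝ)) ∧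
    ∀ X Y : ℝ, p ^ 11 * Y = P ^ 11 * g ^ 7 * X →
      Y / (|P| ^ (1 / 2 : ℝ) * |M| ^ (7 / 4 : ℝ)) = X / (|p| ^ (1 / 2 : ℝ) * |L| ^ (7 / 4 : ℝ)) := by
  have hp := left_ne_zero_of_mul hpP.ne'
  have hP := right_ne_zero_of_mul hpP.ne'
  obtain ⟨u, hu, u4, u2, -, -⟩ := exists_fourth_root hp
  obtain ⟨c, hc, c4, c2, -, -⟩ := exists_fourth_root hP
  obtain ⟨v, hv, v4, -, v3, v7, -⟩ := exists_fourth_root hL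
  obtain ⟨w, hw, w4, -, w3, w7, -⟩ := exists_fourth_root hM
  have hPp : P * u ^ 4 = p * c ^ 4 := by
    rw [← u4, ← c4]
    rcases hp.lt_or_gt with h | h
    · have : P < 0 := neg_of_mul_pos_right hpP h.le
      rw [abs_of_neg h, abs_of_neg this]
      ring
    · have : 0 < P := pos_of_mul_pos_right hpP h.le
      rw [abs_of_pos h, abs_of_pos this]
      ring
  have hf : c ^ 16 * g ^ 3 * f' = u ^ 16 := by
    have hp4 : p ^ 4 = u ^ 16 := by rw [← Even.pow_abs (by decide), u4]; ring
    have hP4 : P ^ 4 = c ^ 16 := by rw [← Even.pow_abs (by decide), c4]; ring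
    rw [← hp4, ← hP4, e0]
  have hw : u ^ 6 * w = c ^ 6 * g * v := by
    refine (pow_left_inj₀ (by positivity) (by positivity) four_ne_zero).1 ?_
    have := congrArg abs e6
    rw [abs_mul, abs_mul, abs_mul, abs_pow, abs_pow, abs_pow, u4, c4, w4, v4, abs_of_pos hg] at this
    linear_combination this
  have hw' : w = c ^ 6 * g * v / u ^ 6 := by field_simp; linear_combination hw
  have hf' : f' = u ^ 16 / (c ^ 16 * g ^ 3) := by field_simp; linear_combination hf
  have hP' : P = p * c ^ 4 / u ^ 4 := by field_simp; linear_combination hPp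
  rw [u2, c2, v3, v7, w3, w7]
  refine ⟨?_, fun X Y hXY => ?_⟩
  · rw [hw', hf']
    field_simp
  · have : Y = c ^ 44 * g ^ 7 * X / u ^ 44 := by
      apply mul_left_cancel₀ (pow_ne_zero 11 hp)
      rw [hXY, hP']
      field_simp
    rw [this, hw']
    field_simp

/-- The value of `I` at the jets of a section is not changed by the transformations. -/
def IsCarriesInvariant (I : JInf → ℝ) : Prop :=
  ∀ (U : Set ℝ) (f g h : ℝ → ℝ) (σ τ : ℝ → Fin 4 → ℝ), Carries U f g h σ τ →
    ∀ x ∈ U, jetInf σ x ∈ Regular → I (jetInf τ (f x)) = I (jetInf σ x)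

theorem Carries.abs_relations {U : Set ℝ} {f g h : ℝ → ℝ} {σ τ : ℝ → Fin 4 → ℝ} {x : ℝ}
    (H : Carries U f g h σ τ) (hx : x ∈ U) (hr : jetInf σ x ∈ Regular) :
    nablaCoeff (jetInf τ (f x)) = deriv f x * nablaCoeff (jetInf σ x) ∧
      J (jetInf τ (f x)) = J (jetInf σ x) := by
  obtain ⟨hg, e0, -⟩ := H.relations hx
  have := QuarticODE.abs_relations (H.sign x hx) hr.2 (H.regular hx hr).2 hg e0 (H.L₁_eq hx)
  exact ⟨by simpa [nablaCoeff, L₀, jetInf] using this.1,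
    by simpa [J, L₀, jetInf] using this.2 _ _ (H.L₂_eq hx)⟩

theorem Carries.hasDerivAt_target_along {U : Set ℝ} {f g h : ℝ → ℝ} {σ τ : ℝ → Fin 4 → ℝ}
    {x : ℝ} (H : Carries U f g h σ τ) (hx : x ∈ U) (hr : jetInf σ x ∈ Regular) {k : ℕ}
    {I : JInf → ℝ} (hI : IsSmoothOfOrder k I) :
    HasDerivAt (fun t => I (jetInf τ (f t))) (totalD I (jetInf τ (f x)) * deriv f x) x :=
  (hasDerivAt_along hI H.isOpen_image H.smooth_target (Set.mem_image_of_mem f hx)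
    (H.regular hx hr)).comp x (H.transf.hasDerivAt_f hx)

theorem isInvariantDerivation_nablaCoeff : IsInvariantDerivation nablaCoeff := by
  refine ⟨⟨1, isSmoothOfOrder_nablaCoeff⟩, fun k F hF U f g h σ τ H x hx hr => ?_⟩
  rw [(H.hasDerivAt_target_along hx hr hF).deriv, (H.abs_relations hx hr).1]
  ring

/-- Invariance holds at all points near x, so it may be differentiated along σ. -/
theorem IsCarriesInvariant.nabla {k : ℕ} {I : JInf → ℝ} (hI : IsSmoothOfOrder k I)
    (hinv : IsCarriesInvariant I) : IsCarriesInvariant (nabla I) := by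
  intro U f g h σ τ H x hx hr
  have h1 := isInvariantDerivation_nablaCoeff.2 k I hI U f g h σ τ H x hx hr
  have h2 : (fun t => I (jetInf τ (f t))) =ᶠ[𝓝 x] fun t => I (jetInf σ t) := by
    filter_upwards [H.isOpen.mem_nhds hx, eventually_jetInf_mem H.isOpen H.smooth_source hx hr]
      with t ht hrt using hinv U f g h σ τ H t ht hrt
  rw [h2.deriv_eq, (hasDerivAt_along hI H.isOpen H.smooth_source hx hr).deriv] at h1
  exact h1.symm

theorem isCarriesInvariant_nabla_iterate_J (i : ℕ) : IsCarriesInvariant (nabla^[i] J) := by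
  induction i with
  | zero => exact fun U f g h σ τ H x hx hr => (H.abs_relations hx hr).2
  | succ i ih =>
    rw [Function.iterate_succ_apply']
    exact ih.nabla (isSmoothOfOrder_nabla_iterate_J i)

theorem coord_eq_of_trunc_eq {k : ℕ} {z w : JInf} (h : trunc k z = trunc k w) (i : Fin 4) {n : ℕ}
    (hn : n ≤ k) : z.2 i n = w.2 i n :=
  congrFun (congrFun (congrArg Prod.snd h) i) ⟨n, Nat.lt_succ_of_le hn⟩

theorem L₀_eq_of_trunc_eq {k : ℕ} {z w : JInf} (h : trunc k z = trunc k w) : L₀ z = L₀ w :=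
  coord_eq_of_trunc_eq h 0 (Nat.zero_le k)

theorem L₁_eq_of_trunc_eq {k : ℕ} (hk : 1 ≤ k) {z w : JInf} (h : trunc k z = trunc k w) :
    L₁ z = L₁ w := by
  have h0 (i : Fin 4) := coord_eq_of_trunc_eq h i (Nat.zero_le k)
  have h1 (i : Fin 4) := coord_eq_of_trunc_eq h i hk
  simp only [L₁, h0, h1]

theorem regular_of_trunc_eq {k : ℕ} (hk : 1 ≤ k) {z w : JInf} (h : trunc k z = trunc k w)
    (hz : z ∈ Regular) : w ∈ Regular :=
  ⟨L₀_eq_of_trunc_eq h ▸ hz.1, L₁_eq_of_trunc_eq hk h ▸ hz.2⟩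

theorem IsSmoothOfOrder.eq_of_trunc_eq {k : ℕ} {I : JInf → ℝ} (hI : IsSmoothOfOrder k I)
    {z w : JInf} (hz : z ∈ Regular) (hw : w ∈ Regular) (h : trunc k z = trunc k w) :
    I z = I w := by
  obtain ⟨F, -, hF⟩ := hI
  rw [hF z hz, hF w hw, h]

/-- The sections realizing an orbit match z and w only to order k. For k ≥ 1 this already decides
regularity, since L₁ has order 1. -/
theorem IsCarriesInvariant.isDiffInvariant {k : ℕ} (hk : 1 ≤ k) {I : JInf → ℝ}
    (hinv : IsCarriesInvariant I) (hI : IsSmoothOfOrder k I) : IsDiffInvariant k I := by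
  refine ⟨hI, ?_⟩
  rintro z hz w hw ⟨U, f, g, h, σ, τ, x, H, hx, hzσ, hwτ⟩
  have hr : jetInf σ x ∈ Regular := regular_of_trunc_eq hk hzσ hz
  rw [hI.eq_of_trunc_eq hz hr hzσ, hI.eq_of_trunc_eq hw (H.regular hx hr) hwτ,
    hinv U f g h σ τ H x hx hr]

theorem isDiffInvariant_nabla_iterate_J (i : ℕ) : IsDiffInvariant (i + 2) (nabla^[i] J) :=
  (isCarriesInvariant_nabla_iterate_J i).isDiffInvariant (by omega)
    (isSmoothOfOrder_nabla_iterate_J i)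

theorem sign_eq_iff_div_abs {a b : ℝ} (ha : a ≠ 0) (hb : b ≠ 0) :
    a / |a| = b / |b| ↔ 0 < a * b := by
  rcases ha.lt_or_gt with h | h <;> rcases hb.lt_or_gt with h' | h'
  · simp [abs_of_neg h, abs_of_neg h', ha, hb, mul_pos_of_neg_of_neg h h']
  · simp only [abs_of_neg h, abs_of_pos h', div_neg, div_self ha, div_self hb]
    norm_num [(mul_neg_of_neg_of_pos h h').le]
  · simp only [abs_of_pos h, abs_of_neg h', div_neg, div_self ha, div_self hb]
    norm_num [(mul_neg_of_pos_of_neg h h').le]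
  · simp [abs_of_pos h, abs_of_pos h', ha, hb, mul_pos h h']

/-- Separation must also distinguish the sign components; on regular points these signs are
themselves smooth invariants. -/
theorem isDiffInvariant_sign_L₀ (k : ℕ) : IsDiffInvariant k fun z => L₀ z / |L₀ z| := by
  refine ⟨(isSmoothOfOrder_L₀ k).div ((isSmoothOfOrder_L₀ k).abs fun z hz => hz.1)
    fun z hz => abs_ne_zero.2 hz.1, ?_⟩
  rintro z hz w hw ⟨U, f, g, h, σ, τ, x, H, hx, hzσ, hwτ⟩
  rw [sign_eq_iff_div_abs hz.1 hw.1, L₀_eq_of_trunc_eq (w := jetInf σ x) hzσ,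
    L₀_eq_of_trunc_eq (w := jetInf τ (f x)) hwτ]
  simpa [L₀, jetInf] using H.sign x hx

theorem isDiffInvariant_sign_L₁ {k : ℕ} (hk : 1 ≤ k) :
    IsDiffInvariant k fun z => L₁ z / |L₁ z| := by
  have hs := isSmoothOfOrder_L₁.mono hk
  refine IsCarriesInvariant.isDiffInvariant hk ?_ (hs.div (hs.abs fun z hz => hz.2)
    fun z hz => abs_ne_zero.2 hz.2)
  intro U f g h σ τ H x hx hr
  rw [sign_eq_iff_div_abs (H.regular hx hr).2 hr.2]
  have hp := H.source_ne hx
  have hP := H.target_ne hx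
  have hg := H.transf.g_ne x hx
  have hL := hr.2
  have : 0 < σ x 0 ^ 6 * (L₁ (jetInf τ (f x)) * L₁ (jetInf σ x)) := by
    rw [← mul_assoc, H.L₁_eq hx, mul_assoc, ← sq]
    positivity
  exact pos_of_mul_pos_right this (by positivity)

/-! ### Jets in normal form -/

/-- The jet at `x` of the coefficients of `y' = (a y) ^ 4 + r(x) y + b`. -/
def normalJet (a b x : ℝ) (r : ℕ → ℝ) : JInf := (x, ![Pi.single 0 a, 0, r, Pi.single 0 b])

theorem L₀_normalJet (a b x : ℝ) (r : ℕ → ℝ) : L₀ (normalJet a b x r) = a := by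
  simp [L₀, normalJet]

theorem L₁_normalJet (a b x : ℝ) (r : ℕ → ℝ) : L₁ (normalJet a b x r) = a ^ 2 * b := by
  simp [L₁, normalJet]

theorem L₂_normalJet (a b x : ℝ) (r : ℕ → ℝ) :
    L₂ (normalJet a b x r) = -4 * a ^ 3 * b * r 0 := by
  simp [L₂, normalJet]
  ring

/-- The line defining the total derivative stays among normal jets, so ∇ can be computed without
leaving them. -/
theorem normalJet_add_smul_totalVec (a b x : ℝ) (r : ℕ → ℝ) (s : ℝ) :
    normalJet a b x r + s • totalVec (normalJet a b x r)
      = normalJet a b (x + s) fun n => r n + s * r (n + 1) := by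
  ext i n
  · simp [normalJet, totalVec]
  · change (normalJet a b x r).2 i n + s * (normalJet a b x r).2 i (n + 1) = _
    fin_cases i <;> simp [normalJet]

theorem normalJet_mem {a b : ℝ} (ha : a ≠ 0) (hb : b ≠ 0) (x : ℝ) (r : ℕ → ℝ) :
    normalJet a b x r ∈ Regular := by
  refine ⟨?_, ?_⟩
  · rwa [L₀_normalJet]
  · rw [L₁_normalJet]
    positivity

theorem nabla_iterate_J_normalJet {a b : ℝ} (ha : |a| = 1) (hb : |b| = 1) (i : ℕ) (x : ℝ)
    (r : ℕ → ℝ) : nabla^[i] J (normalJet a b x r) = -4 * (a * b) * r i := by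
  have ha2 : a ^ 2 = 1 := by rw [← sq_abs, ha, one_pow]
  induction i generalizing x r with
  | zero =>
    simp only [Function.iterate_zero, id, J, L₀_normalJet, L₁_normalJet, L₂_normalJet, ha2, ha,
      hb, one_mul, Real.one_rpow, div_one]
    linear_combination -4 * a * b * r 0 * ha2
  | succ i ih =>
    rw [Function.iterate_succ_apply']
    have h : HasDerivAt (fun s : ℝ => nabla^[i] J
        (normalJet a b x r + s • totalVec (normalJet a b x r))) (-4 * (a * b) * r (i + 1)) 0 := by
      simp only [normalJet_add_smul_totalVec, ih]
      simpa using (((hasDerivAt_id (0 : ℝ)).mul_const (r (i + 1))).const_add (r i)).const_mul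
        (-4 * (a * b))
    have hA : nablaCoeff (normalJet a b x r) = 1 := by
      simp [nablaCoeff, L₀_normalJet, L₁_normalJet, ha2, ha, hb]
    rw [nabla, hA, one_mul]
    exact h.deriv

/-! ### Prolongation of jets with prescribed values of the invariants -/

/-- The direction of the coordinate `q⁽ⁿ⁾`. -/
def qDir (n : ℕ) : JInf := (0, Pi.single 1 (Pi.single n 1))

theorem trunc_add_smul_qDir {k n : ℕ} (h : k < n) (z : JInf) (t : ℝ) :
    trunc k (z + t • qDir n) = trunc k z := by
  ext i m
  · simp [trunc, qDir]
  · have hm : (m : ℕ) ≠ n := by have := m.2; omega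
    by_cases hi : i = 1
    · subst hi
      simp [trunc, qDir, hm]
    · simp [trunc, qDir, hi]

theorem add_smul_qDir_mem {z : JInf} (hz : z ∈ Regular) {n : ℕ} (hn : 1 < n) (t : ℝ) :
    z + t • qDir n ∈ Regular :=
  regular_of_trunc_eq le_rfl (trunc_add_smul_qDir hn z t).symm hz

theorem totalVec_add_smul_qDir (z : JInf) (t : ℝ) (n : ℕ) :
    totalVec (z + t • qDir (n + 1)) = totalVec z + t • qDir n := by
  ext i m
  · simp [totalVec, qDir]
  · by_cases hi : i = 1
    · subst hi
      simp [totalVec, qDir, Pi.single_apply]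
    · simp [totalVec, qDir, hi]

/-- The coefficient of `q⁽ⁱ⁺²⁾` in `∇ⁱ J`. -/
noncomputable def topCoeff : ℕ → JInf → ℝ
  | 0, z => L₀ z * L₀ z / (|L₀ z| ^ (1 / 2 : ℝ) * |L₁ z| ^ (7 / 4 : ℝ))
  | i + 1, z => nablaCoeff z * topCoeff i z

theorem isSmoothOfOrder_topCoeff (i : ℕ) : IsSmoothOfOrder 1 (topCoeff i) := by
  induction i with
  | zero =>
    exact ((isSmoothOfOrder_L₀ 1).mul (isSmoothOfOrder_L₀ 1)).div
      ((isSmoothOfOrder_absPow (isSmoothOfOrder_L₀ 1) (fun _ hz => hz.1) _).mul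
        (isSmoothOfOrder_absPow isSmoothOfOrder_L₁ (fun _ hz => hz.2) _))
      fun _ hz => mul_ne_zero (absPow_L₀_ne hz _) (absPow_L₁_ne hz _)
  | succ i ih => exact isSmoothOfOrder_nablaCoeff.mul ih

theorem topCoeff_ne {z : JInf} (hz : z ∈ Regular) (i : ℕ) : topCoeff i z ≠ 0 := by
  induction i with
  | zero =>
    exact div_ne_zero (mul_ne_zero hz.1 hz.1) (mul_ne_zero (absPow_L₀_ne hz _) (absPow_L₁_ne hz _))
  | succ i ih => exact mul_ne_zero (nablaCoeff_pos hz).ne' ih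

/-- Shifting q⁽ⁱ⁺³⁾ by t tilts the total-derivative line, so that after time s its q⁽ⁱ⁺²⁾ has moved
by st. The shift of q⁽ⁱ⁺³⁾ itself is invisible to ∇ⁱJ. By induction ∇ⁱJ gains st times the top
coefficient, whose derivative at s = 0 is t times that coefficient. -/
theorem nabla_iterate_J_add_smul_qDir (i : ℕ) {z : JInf} (hz : z ∈ Regular) (t : ℝ) :
    nabla^[i] J (z + t • qDir (i + 2)) = nabla^[i] J z + t * topCoeff i z := by
  induction i generalizing z t with
  | zero =>
    have h := trunc_add_smul_qDir one_lt_two z t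
    have e : L₂ (z + t • qDir 2) = L₂ z + t * (L₀ z * L₀ z) := by
      simp [L₂, L₀, qDir]
      ring
    simp only [Function.iterate_zero, id, J, topCoeff, L₀_eq_of_trunc_eq h,
      L₁_eq_of_trunc_eq le_rfl h, zero_add, e]
    ring
  | succ i ih =>
    have hz' := add_smul_qDir_mem hz (show 1 < i + 3 by omega) t
    have hI := isSmoothOfOrder_nabla_iterate_J i
    have h1 : HasDerivAt (fun s : ℝ => nabla^[i] J (z + s • totalVec z)
        + s * t * topCoeff i (z + s • totalVec z)) (totalD (nabla^[i] J) z + t * topCoeff i z) 0 := by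
      have := (hI.hasDerivAt_line hz).add (((hasDerivAt_id (0 : ℝ)).mul_const t).mul
        ((isSmoothOfOrder_topCoeff i).hasDerivAt_line hz))
      exact this.congr_deriv (by simp)
    have h2 : (fun s : ℝ => nabla^[i] J
        (z + t • qDir (i + 3) + s • totalVec (z + t • qDir (i + 3))))
        =ᶠ[𝓝 0] fun s : ℝ => nabla^[i] J (z + s • totalVec z)
        + s * t * topCoeff i (z + s • totalVec z) := by
      filter_upwards [eventually_line_mem hz (totalVec z)] with s hs
      have e : z + t • qDir (i + 3) + s • totalVec (z + t • qDir (i + 3))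
          = (z + s • totalVec z + (s * t) • qDir (i + 2)) + t • qDir (i + 3) := by
        rw [totalVec_add_smul_qDir, mul_smul]
        module
      have hs' := add_smul_qDir_mem hs (show 1 < i + 2 by omega) (s * t)
      rw [e, hI.eq_of_trunc_eq (add_smul_qDir_mem hs' (by omega) t) hs'
        (trunc_add_smul_qDir (by omega) _ t), ih hs]
    have h3 : totalD (nabla^[i] J) (z + t • qDir (i + 3))
        = totalD (nabla^[i] J) z + t * topCoeff i z := (h1.congr_of_eventuallyEq h2).deriv
    rw [Function.iterate_succ_apply']
    change nabla _ (z + t • qDir (i + 3)) = _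
    rw [nabla, nabla, topCoeff, h3,
      isSmoothOfOrder_nablaCoeff.eq_of_trunc_eq hz' hz (trunc_add_smul_qDir (by omega) z t)]
    ring

/-- Each further equality is solved for one new coordinate q⁽ⁿ⁺²⁾ with n ≥ k - 1, which lies above
order k. The 1-jet is tracked separately because for k = 0 the k-jet does not determine L₁. -/
theorem exists_prolongation {k : ℕ} {z w : JInf} (hw : w ∈ Regular)
    (h : ∀ i < k - 1, nabla^[i] J w = nabla^[i] J z) (m : ℕ) :
    ∃ w' ∈ Regular, trunc k w' = trunc k w ∧ trunc 1 w' = trunc 1 w ∧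
      ∀ i < k - 1 + m, nabla^[i] J w' = nabla^[i] J z := by
  induction m with
  | zero => exact ⟨w, hw, rfl, rfl, h⟩
  | succ m ih =>
    obtain ⟨v, hv, hk, h1, hi⟩ := ih
    set n := k - 1 + m with hn
    refine ⟨v + ((nabla^[n] J z - nabla^[n] J v) / topCoeff n v) • qDir (n + 2),
      add_smul_qDir_mem hv (by omega) _, ?_, ?_, fun i hin => ?_⟩
    · rw [trunc_add_smul_qDir (by omega), hk]
    · rw [trunc_add_smul_qDir (by omega), h1]
    · rcases (show i < n ∨ i = n by omega) with hlt | rfl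
      · rw [(isSmoothOfOrder_nabla_iterate_J i).eq_of_trunc_eq
          (add_smul_qDir_mem hv (by omega) _) hv (trunc_add_smul_qDir (by omega) _ _), hi i hlt]
      · rw [nabla_iterate_J_add_smul_qDir _ hv, div_mul_cancel₀ _ (topCoeff_ne hv _)]
        ring

/-- L₁ is affine in q' with slope p. This handles 0-jets, which do not see the sign of L₁. -/
theorem exists_L₁_eq {w : JInf} (hw : w ∈ Regular) {c : ℝ} (hc : c ≠ 0) :
    ∃ w' ∈ Regular, trunc 0 w' = trunc 0 w ∧ L₁ w' = c := by
  have e (t : ℝ) : L₁ (w + t • qDir 1) = L₁ w + t * L₀ w := by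
    simp [L₁, L₀, qDir]
    ring
  have h := trunc_add_smul_qDir zero_lt_one w ((c - L₁ w) / L₀ w)
  have hL : L₁ (w + ((c - L₁ w) / L₀ w) • qDir 1) = c := by
    rw [e, div_mul_cancel₀ _ hw.1]
    ring
  refine ⟨_, ⟨?_, ?_⟩, h, hL⟩
  · rw [L₀_eq_of_trunc_eq h]
    exact hw.1
  · rw [hL]
    exact hc

/-! ### Sections with a given jet, and canonical parameters -/

theorem exists_contDiff_iteratedDeriv_eq (m : ℕ) (a : ℕ → ℝ) (x : ℝ) :
    ∃ φ : ℝ → ℝ, ContDiff ℝ ∞ φ ∧ ∀ n ≤ m, iteratedDeriv n φ x = a n := by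
  induction m generalizing a with
  | zero =>
    refine ⟨fun _ => a 0, contDiff_const, fun n hn => ?_⟩
    obtain rfl : n = 0 := by omega
    simp
  | succ m ih =>
    obtain ⟨φ, hφ, h⟩ := ih fun n => a (n + 1)
    have hd (t : ℝ) : HasDerivAt (fun t => a 0 + ∫ s in x..t, φ s) (φ t) t :=
      (intervalIntegral.integral_hasDerivAt_right (hφ.continuous.intervalIntegrable _ _)
        (hφ.continuous.stronglyMeasurableAtFilter _ _) hφ.continuous.continuousAt).const_add _
    have hderiv : deriv (fun t => a 0 + ∫ s in x..t, φ s) = φ := funext fun t => (hd t).deriv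
    refine ⟨fun t => a 0 + ∫ s in x..t, φ s,
      contDiff_infty_iff_deriv.2 ⟨fun t => (hd t).differentiableAt, by rwa [hderiv]⟩, ?_⟩
    rintro (_ | n) hn
    · simp
    · rw [iteratedDeriv_succ', hderiv]
      exact h n (by omega)

theorem exists_section_of_jet (m : ℕ) (z : JInf) :
    ∃ σ : ℝ → Fin 4 → ℝ, ContDiff ℝ ∞ σ ∧ trunc m (jetInf σ z.1) = trunc m z := by
  choose φ hφ h using fun i => exists_contDiff_iteratedDeriv_eq m (z.2 i) z.1
  refine ⟨fun t i => φ i t, contDiff_pi.2 hφ, ?_⟩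
  ext i n
  · rfl
  · exact h i n (Nat.le_of_lt_succ n.2)

theorem exists_primitive {x ε : ℝ} (hε : 0 < ε) {φ : ℝ → ℝ}
    (hφ : ContDiffOn ℝ ∞ φ (Metric.ball x ε)) :
    ∃ f : ℝ → ℝ, f x = 0 ∧ ContDiffOn ℝ ∞ f (Metric.ball x ε) ∧
      ∀ t ∈ Metric.ball x ε, deriv f t = φ t := by
  have hd (t : ℝ) (ht : t ∈ Metric.ball x ε) : HasDerivAt (fun t => ∫ s in x..t, φ s) (φ t) t := by
    have hsub : Set.uIcc x t ⊆ Metric.ball x ε :=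
      (convex_ball x ε).ordConnected.uIcc_subset (Metric.mem_ball_self hε) ht
    exact intervalIntegral.integral_hasDerivAt_right
      (hφ.continuousOn.mono hsub).intervalIntegrable
      (hφ.continuousOn.stronglyMeasurableAtFilter Metric.isOpen_ball t ht)
      (hφ.continuousOn.continuousAt (Metric.isOpen_ball.mem_nhds ht))
  refine ⟨fun t => ∫ s in x..t, φ s, by simp, ?_, fun t ht => (hd t ht).deriv⟩
  refine (contDiffOn_infty_iff_deriv_of_isOpen Metric.isOpen_ball).2
    ⟨fun t ht => (hd t ht).differentiableAt.differentiableWithinAt, ?_⟩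
  exact hφ.congr fun t ht => (hd t ht).deriv

theorem exists_smooth_inverse {U : Set ℝ} {f : ℝ → ℝ} (hU : IsOpen U) (hf : ContDiffOn ℝ ∞ f U)
    (hinj : Set.InjOn f U) (hd : ∀ t ∈ U, 0 < deriv f t) :
    ∃ ψ : ℝ → ℝ, ContDiffOn ℝ ∞ ψ (f '' U) ∧ ∀ t ∈ U, ψ (f t) = t := by
  have hopen : IsOpenMap (U.domRestrict f) := by
    intro s hs
    obtain ⟨s', hs', rfl⟩ := isOpen_induced_iff.1 hs
    have : U.domRestrict f '' (Subtype.val ⁻¹' s') = f '' (U ∩ s') := by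
      rw [Set.domRestrict_eq, Set.image_comp, Subtype.image_preimage_coe]
    rw [this]
    exact isOpen_image_of_deriv_pos (hU.inter hs') (hf.mono Set.inter_subset_left)
      fun t ht => hd t ht.1
  let e := OpenPartialHomeomorph.ofContinuousOpenRestrict (hinj.toPartialEquiv f U)
    hf.continuousOn hopen hU
  refine ⟨e.symm, ?_, fun t ht => e.left_inv ht⟩
  rintro _ ⟨t, ht, rfl⟩
  have hft := hf.contDiffAt (hU.mem_nhds ht)
  have he : e.symm (f t) = t := e.left_inv ht
  refine (e.contDiffAt_symm_deriv (hd t ht).ne' (e.map_source ht) ?_ ?_).contDiffWithinAt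
  · change HasDerivAt f _ (e.symm (f t))
    rw [he]
    exact (hft.differentiableAt (by simp)).hasDerivAt
  · change ContDiffAt ℝ ∞ f (e.symm (f t))
    rwa [he]

/-- In the parameter f = ∫ dx / `nablaCoeff` the derivation ∇ becomes d/df. The ball is small enough
that both signs are constant. -/
theorem exists_canonicalParameter {σ : ℝ → Fin 4 → ℝ} (hσ : ContDiff ℝ ∞ σ) {x : ℝ}
    (hr : jetInf σ x ∈ Regular) : ∃ (B : Set ℝ) (f : ℝ → ℝ), IsOpen B ∧ x ∈ B ∧
      ContDiffOn ℝ ∞ f B ∧ Set.InjOn f B ∧ f x = 0 ∧ ∀ t ∈ B,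
        0 < L₀ (jetInf σ t) * L₀ (jetInf σ x) ∧ 0 < L₁ (jetInf σ t) * L₁ (jetInf σ x) ∧
        deriv f t = (nablaCoeff (jetInf σ t))⁻¹ := by
  have hσ' : ContDiffOn ℝ ∞ σ Set.univ := hσ.contDiffOn
  have hc : Continuous (jetInf σ) := continuousOn_univ.1 (continuousOn_jetInf isOpen_univ hσ')
  have hc₀ : Continuous fun t => L₀ (jetInf σ t) * L₀ (jetInf σ x) := by
    have : Continuous L₀ := by unfold L₀; fun_prop
    exact (this.comp hc).mul continuous_const
  have hc₁ : Continuous fun t => L₁ (jetInf σ t) * L₁ (jetInf σ x) :=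
    (continuous_L₁.comp hc).mul continuous_const
  have h0 : ∀ᶠ t in 𝓝 x, 0 < L₀ (jetInf σ t) * L₀ (jetInf σ x) ∧
      0 < L₁ (jetInf σ t) * L₁ (jetInf σ x) :=
    (continuousAt_const.eventually_lt hc₀.continuousAt (mul_self_pos.2 hr.1)).and
      (continuousAt_const.eventually_lt hc₁.continuousAt (mul_self_pos.2 hr.2))
  obtain ⟨ε, hε, hB⟩ := Metric.eventually_nhds_iff_ball.1 h0
  have hreg : ∀ t ∈ Metric.ball x ε, jetInf σ t ∈ Regular := fun t ht =>
    ⟨left_ne_zero_of_mul (hB t ht).1.ne', left_ne_zero_of_mul (hB t ht).2.ne'⟩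
  have hA : ContDiffOn ℝ ∞ (fun t => (nablaCoeff (jetInf σ t))⁻¹) (Metric.ball x ε) :=
    (contDiffOn_along isSmoothOfOrder_nablaCoeff Metric.isOpen_ball (hσ'.mono (Set.subset_univ _))
      hreg).inv fun t ht => (nablaCoeff_pos (hreg t ht)).ne'
  obtain ⟨f, hfx, hf, hfd⟩ := exists_primitive hε hA
  refine ⟨_, f, Metric.isOpen_ball, Metric.mem_ball_self hε, hf, ?_, hfx, fun t ht =>
    ⟨(hB t ht).1, (hB t ht).2, hfd t ht⟩⟩
  refine (strictMonoOn_of_deriv_pos (convex_ball x ε) hf.continuousOn fun t ht => ?_).injOn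
  rw [Metric.isOpen_ball.interior_eq] at ht
  rw [hfd t ht]
  exact inv_pos.2 (nablaCoeff_pos (hreg t ht))

/-- The map f is the canonical parameter of σ followed by the inverse of that of ρ; ψ is its
inverse. -/
theorem exists_change_of_parameter {σ ρ : ℝ → Fin 4 → ℝ} (hσ : ContDiff ℝ ∞ σ)
    (hρ : ContDiff ℝ ∞ ρ) {x y : ℝ} (hx : jetInf σ x ∈ Regular) (hy : jetInf ρ y ∈ Regular)
    (h₀ : 0 < L₀ (jetInf σ x) * L₀ (jetInf ρ y)) (h₁ : 0 < L₁ (jetInf σ x) * L₁ (jetInf ρ y)) :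
    ∃ (U : Set ℝ) (f ψ : ℝ → ℝ), IsOpen U ∧ x ∈ U ∧ f x = y ∧ ContDiffOn ℝ ∞ f U ∧
      Set.InjOn f U ∧ IsOpen (f '' U) ∧ ContDiffOn ℝ ∞ ψ (f '' U) ∧ ∀ t ∈ U, ψ (f t) = t ∧
        0 < L₀ (jetInf σ t) * L₀ (jetInf ρ (f t)) ∧ 0 < L₁ (jetInf σ t) * L₁ (jetInf ρ (f t)) ∧
        deriv f t = nablaCoeff (jetInf ρ (f t)) / nablaCoeff (jetInf σ t) := by
  obtain ⟨B₁, f₁, hB₁, hx₁, hf₁, hinj₁, hf₁x, H₁⟩ := exists_canonicalParameter hσ hx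
  obtain ⟨B₂, f₂, hB₂, hy₂, hf₂, hinj₂, hf₂y, H₂⟩ := exists_canonicalParameter hρ hy
  have r₁ : ∀ t ∈ B₁, jetInf σ t ∈ Regular := fun t ht =>
    ⟨left_ne_zero_of_mul (H₁ t ht).1.ne', left_ne_zero_of_mul (H₁ t ht).2.1.ne'⟩
  have r₂ : ∀ t ∈ B₂, jetInf ρ t ∈ Regular := fun t ht =>
    ⟨left_ne_zero_of_mul (H₂ t ht).1.ne', left_ne_zero_of_mul (H₂ t ht).2.1.ne'⟩
  have hd₂ : ∀ t ∈ B₂, 0 < deriv f₂ t := fun t ht => by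
    rw [(H₂ t ht).2.2]
    exact inv_pos.2 (nablaCoeff_pos (r₂ t ht))
  have hV₂ : IsOpen (f₂ '' B₂) := isOpen_image_of_deriv_pos hB₂ hf₂ hd₂
  obtain ⟨φ, hφ, hφf⟩ := exists_smooth_inverse hB₂ hf₂ hinj₂ hd₂
  have hU : IsOpen (B₁ ∩ f₁ ⁻¹' (f₂ '' B₂)) := hf₁.continuousOn.isOpen_inter_preimage hB₁ hV₂
  have hf : ContDiffOn ℝ ∞ (fun t => φ (f₁ t)) (B₁ ∩ f₁ ⁻¹' (f₂ '' B₂)) :=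
    hφ.comp (hf₁.mono Set.inter_subset_left) fun t ht => ht.2
  have hmem : ∀ t ∈ B₁ ∩ f₁ ⁻¹' (f₂ '' B₂), φ (f₁ t) ∈ B₂ ∧ f₂ (φ (f₁ t)) = f₁ t := by
    rintro t ⟨-, u, hu, hut⟩
    rw [← hut, hφf u hu]
    exact ⟨hu, rfl⟩
  have hinj : Set.InjOn (fun t => φ (f₁ t)) (B₁ ∩ f₁ ⁻¹' (f₂ '' B₂)) := by
    intro s hs t ht hst
    refine hinj₁ hs.1 ht.1 ?_
    rw [← (hmem s hs).2, ← (hmem t ht).2]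
    exact congrArg f₂ hst
  have hderiv : ∀ t ∈ B₁ ∩ f₁ ⁻¹' (f₂ '' B₂), deriv (fun t => φ (f₁ t)) t
      = nablaCoeff (jetInf ρ (φ (f₁ t))) / nablaCoeff (jetInf σ t) := by
    intro t ht
    have d₂ : HasDerivAt f₂ (nablaCoeff (jetInf ρ (φ (f₁ t))))⁻¹ (φ (f₁ t)) := by
      rw [← (H₂ _ (hmem t ht).1).2.2]
      exact ((hf₂.contDiffAt (hB₂.mem_nhds (hmem t ht).1)).differentiableAt (by simp)).hasDerivAt
    have d := ((hf.contDiffAt (hU.mem_nhds ht)).differentiableAt (by simp)).hasDerivAt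
    have d₁ : HasDerivAt f₁ (nablaCoeff (jetInf σ t))⁻¹ t := by
      rw [← (H₁ t ht.1).2.2]
      exact ((hf₁.contDiffAt (hB₁.mem_nhds ht.1)).differentiableAt (by simp)).hasDerivAt
    have e := (d₂.comp t d).unique (d₁.congr_of_eventuallyEq <| by
      filter_upwards [hU.mem_nhds ht] with s hs using (hmem s hs).2)
    have n := (nablaCoeff_pos (r₂ _ (hmem t ht).1)).ne'
    rw [div_eq_mul_inv, ← e, mul_inv_cancel_left₀ n]
  have hpos : ∀ t ∈ B₁ ∩ f₁ ⁻¹' (f₂ '' B₂), 0 < deriv (fun t => φ (f₁ t)) t := fun t ht => by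
    rw [hderiv t ht]
    exact div_pos (nablaCoeff_pos (r₂ _ (hmem t ht).1)) (nablaCoeff_pos (r₁ t ht.1))
  obtain ⟨ψ, hψ, hψf⟩ := exists_smooth_inverse hU hf hinj hpos
  have hxU : x ∈ B₁ ∩ f₁ ⁻¹' (f₂ '' B₂) := ⟨hx₁, y, hy₂, by rw [hf₁x, hf₂y]⟩
  have key {a b c d : ℝ} (h : 0 < a * b) (h' : 0 < c * d) (h'' : 0 < b * d) : 0 < a * c := by
    refine pos_of_mul_pos_left (b := b * d) ?_ h''.le
    calc 0 < a * b * (c * d) := mul_pos h h'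
      _ = _ := by ring
  refine ⟨_, fun t => φ (f₁ t), ψ, hU, hxU, ?_, hf, hinj, isOpen_image_of_deriv_pos hU hf hpos, hψ,
    fun t ht => ⟨hψf t ht, key (H₁ t ht.1).1 (H₂ _ (hmem t ht).1).1 h₀,
      key (H₁ t ht.1).2.1 (H₂ _ (hmem t ht).1).2.1 h₁, hderiv t ht⟩⟩
  change φ (f₁ x) = y
  rw [hf₁x, ← hf₂y, hφf y hy₂]

/-- Differentiating bEᵢ gives b'Eᵢ + bcEᵢ₊₁, again a sum of terms of the same kind; the arbitrary
factor b keeps the induction closed. -/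
theorem iteratedDeriv_mul_eq_zero {V : Set ℝ} (hV : IsOpen V) {x : ℝ} (hx : x ∈ V) {k : ℕ}
    {E : ℕ → ℝ → ℝ} {c : ℝ → ℝ} (hc : ContDiffOn ℝ ∞ c V) (hE : ∀ i, ContDiffOn ℝ ∞ (E i) V)
    (hd : ∀ i, ∀ u ∈ V, HasDerivAt (E i) (E (i + 1) u * c u) u) (h0 : ∀ i ≤ k, E i x = 0)
    {n i : ℕ} (hin : i + n ≤ k) {b : ℝ → ℝ} (hb : ContDiffOn ℝ ∞ b V) :
    iteratedDeriv n (fun u => b u * E i u) x = 0 := by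
  induction n generalizing i b with
  | zero => simp [h0 i (by omega)]
  | succ n ih =>
    have hb' : ContDiffOn ℝ ∞ (deriv b) V := hb.deriv_of_isOpen hV le_rfl
    have e : deriv (fun u => b u * E i u)
        =ᶠ[𝓝 x] fun u => deriv b u * E i u + b u * c u * E (i + 1) u := by
      filter_upwards [hV.mem_nhds hx] with u hu
      have hbu := ((hb.contDiffAt (hV.mem_nhds hu)).differentiableAt (by simp)).hasDerivAt
      rw [(hbu.fun_mul (hd i u hu)).deriv]
      ring
    rw [iteratedDeriv_succ', e.iteratedDeriv_eq, iteratedDeriv_fun_add,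
      ih (by omega) hb', ih (by omega) (hb.mul hc), add_zero]
    · exact ((hb'.mul (hE i)).contDiffAt (hV.mem_nhds hx)).of_le (by exact_mod_cast le_top)
    · exact (((hb.mul hc).mul (hE (i + 1))).contDiffAt (hV.mem_nhds hx)).of_le
        (by exact_mod_cast le_top)

/-! ### Transformations between sections with equal invariants -/

/-- The factor `g` of the transformation which normalizes `|p|` and `|L₁|` to `1`. -/
noncomputable def gCoeff (z : JInf) : ℝ := |L₀ z| ^ (3 / 2 : ℝ) / |L₁ z| ^ (1 / 4 : ℝ)

theorem isSmoothOfOrder_gCoeff : IsSmoothOfOrder 1 gCoeff :=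
  (isSmoothOfOrder_absPow (isSmoothOfOrder_L₀ 1) (fun _ hz => hz.1) _).div
    (isSmoothOfOrder_absPow isSmoothOfOrder_L₁ (fun _ hz => hz.2) _)
    fun _ hz => absPow_L₁_ne hz _

theorem gCoeff_pos {z : JInf} (hz : z ∈ Regular) : 0 < gCoeff z :=
  div_pos (Real.rpow_pos_of_pos (abs_pos.2 hz.1) _) (Real.rpow_pos_of_pos (abs_pos.2 hz.2) _)

theorem gCoeff_relations {z w : JInf} (hz : z ∈ Regular) (hw : w ∈ Regular)
    (h₁ : 0 < L₁ z * L₁ w) :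
    L₀ w ^ 4 * (gCoeff z / gCoeff w) ^ 3 * (nablaCoeff w / nablaCoeff z) = L₀ z ^ 4 ∧
      nablaCoeff w / nablaCoeff z * L₁ w * L₀ z ^ 2 = gCoeff z / gCoeff w * L₁ z * L₀ w ^ 2 := by
  obtain ⟨u, hu, u4, u2, -, -, -, u6⟩ := exists_fourth_root hz.1
  obtain ⟨c, hc, c4, c2, -, -, -, c6⟩ := exists_fourth_root hw.1
  obtain ⟨v, hv, v4, -, v3, -, v1, -⟩ := exists_fourth_root hz.2
  obtain ⟨b, hb, b4, -, b3, -, b1, -⟩ := exists_fourth_root hw.2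
  have hu2 : L₀ z ^ 2 = u ^ 8 := by rw [← sq_abs, u4]; ring
  have hc2 : L₀ w ^ 2 = c ^ 8 := by rw [← sq_abs, c4]; ring
  have hu4 : L₀ z ^ 4 = u ^ 16 := by linear_combination (L₀ z ^ 2 + u ^ 8) * hu2
  have hc4 : L₀ w ^ 4 = c ^ 16 := by linear_combination (L₀ w ^ 2 + c ^ 8) * hc2
  have hL : L₁ w * v ^ 4 = L₁ z * b ^ 4 := by
    rw [← v4, ← b4]
    rcases hz.2.lt_or_gt with h | h
    · rw [abs_of_neg h, abs_of_neg (neg_of_mul_pos_right h₁ h.le)]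
      ring
    · rw [abs_of_pos h, abs_of_pos (pos_of_mul_pos_right h₁ h.le)]
      ring
  have hL' : L₁ w = L₁ z * b ^ 4 / v ^ 4 := by field_simp; linear_combination hL
  simp only [gCoeff, nablaCoeff, hu2, hc2, hu4, hc4, u2, c2, u6, c6, v3, b3, v1, b1]
  constructor
  · field_simp
  · rw [hL']
    field_simp

/-- The invariant `J` is, up to this factor, the coefficient `r` in the normal form. -/
noncomputable def jCoeff (z : JInf) : ℝ :=
  L₀ z / |L₀ z| * (L₁ z / |L₁ z|) / (4 * nablaCoeff z)

theorem isSmoothOfOrder_jCoeff : IsSmoothOfOrder 1 jCoeff :=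
  ((((isSmoothOfOrder_L₀ 1).div ((isSmoothOfOrder_L₀ 1).abs fun _ hz => hz.1)
    fun _ hz => abs_ne_zero.2 hz.1).mul (isSmoothOfOrder_L₁.div
      (isSmoothOfOrder_L₁.abs fun _ hz => hz.2) fun _ hz => abs_ne_zero.2 hz.2)).div
    ((IsSmoothOfOrder.const 1 4).mul isSmoothOfOrder_nablaCoeff)
    fun _ hz => mul_ne_zero four_ne_zero (nablaCoeff_pos hz).ne')

theorem jCoeff_eq {z w : JInf} (hz : z ∈ Regular) (hw : w ∈ Regular) (h₀ : 0 < L₀ z * L₀ w)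
    (h₁ : 0 < L₁ z * L₁ w) : jCoeff z = nablaCoeff w / nablaCoeff z * jCoeff w := by
  have := nablaCoeff_pos hz
  have := nablaCoeff_pos hw
  rw [jCoeff, jCoeff, (sign_eq_iff_div_abs hz.1 hw.1).2 h₀, (sign_eq_iff_div_abs hz.2 hw.2).2 h₁]
  field_simp

/-- The added term is the logarithmic derivative of `gCoeff`, so the left side is the coefficient r
after rescaling y by that factor; it equals -L₂/(4L₀L₁). -/
theorem normalized_r_eq {z : JInf} (hz : z ∈ Regular) :
    z.2 2 0 + (3 / 2 * (z.2 0 1 / L₀ z) - 1 / 4 * (DL₁ z / L₁ z)) = -(J z * jCoeff z) := by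
  have e : J z * jCoeff z = L₂ z / (4 * L₀ z * L₁ z) := by
    obtain ⟨u, hu, u4, u2, -⟩ := exists_fourth_root hz.1
    obtain ⟨v, hv, v4, -, v3, v7, -⟩ := exists_fourth_root hz.2
    have hu2 : L₀ z ^ 2 = u ^ 8 := by rw [← sq_abs, u4]; ring
    have hv2 : L₁ z ^ 2 = v ^ 8 := by rw [← sq_abs, v4]; ring
    have h0 := hz.1
    have h1 := hz.2
    rw [J, jCoeff, nablaCoeff, u2, v7, v3, u4, v4]
    field_simp
    rw [hu2, hv2]
  have h0 : z.2 0 0 ≠ 0 := hz.1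
  have h1 := hz.2
  rw [e, L₂_eq, L₀]
  field_simp
  ring

theorem hasDerivAt_absPow {φ : ℝ → ℝ} {φ' t : ℝ} (h : HasDerivAt φ φ' t) (h0 : φ t ≠ 0) (a : ℝ) :
    HasDerivAt (fun s => |φ s| ^ a) (|φ t| ^ a * (a * (φ' / φ t))) t := by
  have e {s : ℝ} (hs : φ s ≠ 0) : |φ s| ^ a = Real.exp (a * Real.log (φ s)) := by
    rw [Real.rpow_def_of_pos (abs_pos.2 hs), Real.log_abs, mul_comm]
  rw [e h0]
  refine ((h.log h0).const_mul a).exp.congr_of_eventuallyEq ?_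
  filter_upwards [h.continuousAt.eventually_ne h0] with s hs using e hs

theorem hasDerivAt_gCoeff {σ : ℝ → Fin 4 → ℝ} (hσ : ContDiff ℝ ∞ σ) {t : ℝ}
    (hr : jetInf σ t ∈ Regular) : HasDerivAt (fun t => gCoeff (jetInf σ t))
      (gCoeff (jetInf σ t) * (3 / 2 * ((jetInf σ t).2 0 1 / L₀ (jetInf σ t))
        - 1 / 4 * (DL₁ (jetInf σ t) / L₁ (jetInf σ t)))) t := by
  have h₀ : HasDerivAt (fun t => L₀ (jetInf σ t)) ((jetInf σ t).2 0 1) t := by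
    simpa [L₀, jetInf] using hasDerivAt_section isOpen_univ hσ.contDiffOn 0 (Set.mem_univ t)
  have h₁ := hasDerivAt_L₁ isOpen_univ hσ.contDiffOn (Set.mem_univ t)
  have n := absPow_L₁_ne hr (1 / 4)
  refine ((hasDerivAt_absPow h₀ hr.1 (3 / 2)).div (hasDerivAt_absPow h₁ hr.2 (1 / 4)) n).congr_deriv
    ?_
  rw [gCoeff]
  field_simp

/-- The section `ρ` with `r` and `s` changed so that its invariant `J` at `u` becomes the
invariant of `σ` at `ψ u`. -/
noncomputable def adapted (σ ρ : ℝ → Fin 4 → ℝ) (ψ : ℝ → ℝ) (u : ℝ) : Fin 4 → ℝ :=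
  let d := -jCoeff (jetInf ρ u) * (J (jetInf σ (ψ u)) - J (jetInf ρ u))
  ![ρ u 0, ρ u 1, ρ u 2 + d, ρ u 3 + ρ u 1 / ρ u 0 * d]

section Adapted

variable {σ ρ : ℝ → Fin 4 → ℝ} {U : Set ℝ} {f ψ : ℝ → ℝ}

/-- The choice of f and g matches p and L₁, and h matches q/p. Only r can then differ from that of
ρ, by a multiple of the difference of the J's. The change of s is q/p times that of r, which leaves
L₁ unchanged. -/
theorem carries_adapted (hσ : ContDiff ℝ ∞ σ) (hρ : ContDiff ℝ ∞ ρ) (hU : IsOpen U)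
    (hf : ContDiffOn ℝ ∞ f U) (hinj : Set.InjOn f U) (hV : IsOpen (f '' U))
    (hψ : ContDiffOn ℝ ∞ ψ (f '' U)) (hψf : ∀ t ∈ U, ψ (f t) = t)
    (h₀ : ∀ t ∈ U, 0 < L₀ (jetInf σ t) * L₀ (jetInf ρ (f t)))
    (h₁ : ∀ t ∈ U, 0 < L₁ (jetInf σ t) * L₁ (jetInf ρ (f t)))
    (hd : ∀ t ∈ U, deriv f t = nablaCoeff (jetInf ρ (f t)) / nablaCoeff (jetInf σ t)) :
    ∃ g h, Carries U f g h σ (adapted σ ρ ψ) := by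
  have rσ : ∀ t ∈ U, jetInf σ t ∈ Regular := fun t ht =>
    ⟨left_ne_zero_of_mul (h₀ t ht).ne', left_ne_zero_of_mul (h₁ t ht).ne'⟩
  have rρ : ∀ t ∈ U, jetInf ρ (f t) ∈ Regular := fun t ht =>
    ⟨right_ne_zero_of_mul (h₀ t ht).ne', right_ne_zero_of_mul (h₁ t ht).ne'⟩
  have rρ' : ∀ u ∈ f '' U, jetInf ρ u ∈ Regular := by
    rintro _ ⟨t, ht, rfl⟩
    exact rρ t ht
  have eσ (t : ℝ) : L₀ (jetInf σ t) = σ t 0 := by simp [L₀, jetInf]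
  have eρ (t : ℝ) : L₀ (jetInf ρ t) = ρ t 0 := by simp [L₀, jetInf]
  have nσ : ∀ t ∈ U, σ t 0 ≠ 0 := fun t ht => eσ t ▸ (rσ t ht).1
  have nρ : ∀ t ∈ U, ρ (f t) 0 ≠ 0 := fun t ht => eρ (f t) ▸ (rρ t ht).1
  have nρ' : ∀ u ∈ f '' U, ρ u 0 ≠ 0 := fun t ht => eρ t ▸ (rρ' t ht).1
  have hfm : Set.MapsTo f U (f '' U) := Set.mapsTo_image f U
  have sσ (i : Fin 4) : ContDiffOn ℝ ∞ (fun t => σ t i) U := (contDiff_pi.1 hσ i).contDiffOn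
  have sρ (i : Fin 4) : ContDiffOn ℝ ∞ (fun t => ρ t i) (f '' U) :=
    (contDiff_pi.1 hρ i).contDiffOn
  have sg : ContDiffOn ℝ ∞ (fun t => gCoeff (jetInf σ t) / gCoeff (jetInf ρ (f t))) U :=
    (contDiffOn_along isSmoothOfOrder_gCoeff hU hσ.contDiffOn rσ).div
      ((contDiffOn_along isSmoothOfOrder_gCoeff hV hρ.contDiffOn rρ').comp hf hfm)
      fun t ht => (gCoeff_pos (rρ t ht)).ne'
  have sh : ContDiffOn ℝ ∞ (fun t => gCoeff (jetInf σ t) / gCoeff (jetInf ρ (f t))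
      * (σ t 1 / σ t 0) - ρ (f t) 1 / ρ (f t) 0) U :=
    (sg.mul ((sσ 1).div (sσ 0) nσ)).sub (((sρ 1).comp hf hfm).div ((sρ 0).comp hf hfm) nρ)
  have hψm : Set.MapsTo ψ (f '' U) U := by
    rintro _ ⟨t, ht, rfl⟩
    rwa [hψf t ht]
  have sd : ContDiffOn ℝ ∞
      (fun u => -jCoeff (jetInf ρ u) * (J (jetInf σ (ψ u)) - J (jetInf ρ u))) (f '' U) :=
    (contDiffOn_along isSmoothOfOrder_jCoeff hV hρ.contDiffOn rρ').neg.mul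
      (((contDiffOn_along isSmoothOfOrder_J hU hσ.contDiffOn rσ).comp hψ hψm).sub
        (contDiffOn_along isSmoothOfOrder_J hV hρ.contDiffOn rρ'))
  refine ⟨fun t => gCoeff (jetInf σ t) / gCoeff (jetInf ρ (f t)), fun t =>
    gCoeff (jetInf σ t) / gCoeff (jetInf ρ (f t)) * (σ t 1 / σ t 0) - ρ (f t) 1 / ρ (f t) 0,
    ⟨hU, hf, sg, sh, hinj, fun t ht => ?_, fun t ht => ?_⟩, hσ.contDiffOn,
    contDiffOn_pi.2 fun i => ?_, fun t ht => ?_, fun t ht => ?_⟩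
  · rw [hd t ht]
    exact div_pos (nablaCoeff_pos (rρ t ht)) (nablaCoeff_pos (rσ t ht))
  · exact (div_pos (gCoeff_pos (rσ t ht)) (gCoeff_pos (rρ t ht))).ne'
  · fin_cases i
    · exact sρ 0
    · exact sρ 1
    · exact (sρ 2).add sd
    · exact (sρ 3).add (((sρ 1).div (sρ 0) nρ').mul sd)
  · have := h₀ t ht
    rwa [eσ, eρ] at this
  · have dσ (i : Fin 4) := hasDerivAt_section isOpen_univ hσ.contDiffOn i (Set.mem_univ t)
    have df : HasDerivAt f (deriv f t) t :=
      ((hf.contDiffAt (hU.mem_nhds ht)).differentiableAt (by simp)).hasDerivAt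
    have dρ (i : Fin 4) : HasDerivAt (fun t => ρ (f t) i)
        ((jetInf ρ (f t)).2 i 1 * deriv f t) t :=
      (hasDerivAt_section isOpen_univ hρ.contDiffOn i (Set.mem_univ (f t))).comp t df
    have dg₂ : HasDerivAt (fun t => gCoeff (jetInf ρ (f t))) _ t :=
      (hasDerivAt_gCoeff hρ (rρ t ht)).comp t df
    have pg₂ := gCoeff_pos (rρ t ht)
    have dg := (hasDerivAt_gCoeff hσ (rσ t ht)).fun_div dg₂ pg₂.ne'
    have dh := (dg.fun_mul ((dσ 1).fun_div (dσ 0) (nσ t ht))).fun_sub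
      ((dρ 1).fun_div (dρ 0) (nρ t ht))
    have hp := nσ t ht
    have hP := nρ t ht
    obtain ⟨e0, e6⟩ := gCoeff_relations (rσ t ht) (rρ t ht) (h₁ t ht)
    have n₁ := normalized_r_eq (rσ t ht)
    have n₂ := normalized_r_eq (rρ t ht)
    have ej := jCoeff_eq (rσ t ht) (rρ t ht) (h₀ t ht) (h₁ t ht)
    rw [← hd t ht] at e0 e6 ej
    simp only [eσ, eρ] at e0 e6
    set g := gCoeff (jetInf σ t) / gCoeff (jetInf ρ (f t)) with hg
    have dg' : deriv (fun t => gCoeff (jetInf σ t) / gCoeff (jetInf ρ (f t))) t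
        = g * ((-(J (jetInf σ t) * jCoeff (jetInf σ t)) - σ t 2)
          - deriv f t * (-(J (jetInf ρ (f t)) * jCoeff (jetInf ρ (f t))) - ρ (f t) 2)) := by
      rw [dg.deriv, ← n₁, ← n₂, hg]
      simp only [jetInf, iteratedDeriv_zero]
      field_simp
      ring
    have hR : deriv f t * adapted σ ρ ψ (f t) 2 * g
        = deriv (fun t => gCoeff (jetInf σ t) / gCoeff (jetInf ρ (f t))) t + g * σ t 2 := by
      rw [dg']
      simp only [adapted, hψf t ht, Matrix.cons_val]
      rw [ej]
      ring
    intro y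
    refine rhs_eqn_of_relations hp (P := ρ (f t) 0) (Q := ρ (f t) 1) e0 ?_ hR ?_ y
    · field_simp
      ring
    · rw [dh.deriv, ← dg.deriv]
      have hL₁ : L₁ (jetInf σ t) = (jetInf σ t).2 1 1 * σ t 0 - (jetInf σ t).2 0 1 * σ t 1
          + σ t 0 ^ 2 * σ t 3 - σ t 0 * σ t 1 * σ t 2 := by simp [L₁, jetInf]
      have hM₁ : L₁ (jetInf ρ (f t)) = (jetInf ρ (f t)).2 1 1 * ρ (f t) 0
          - (jetInf ρ (f t)).2 0 1 * ρ (f t) 1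
          + ρ (f t) 0 ^ 2 * ρ (f t) 3 - ρ (f t) 0 * ρ (f t) 1 * ρ (f t) 2 := by simp [L₁, jetInf]
      rw [hL₁, hM₁] at e6
      have hS : adapted σ ρ ψ (f t) 3 = ρ (f t) 3
          + ρ (f t) 1 / ρ (f t) 0 * (adapted σ ρ ψ (f t) 2 - ρ (f t) 2) := by
        simp [adapted]
      rw [hS]
      -- This is the law of L₁ divided by the squares of the p's: L₁/p² = (q/p)' + s - (q/p)r.
      have e7 : deriv f t * (((jetInf ρ (f t)).2 1 1 * ρ (f t) 0
          - (jetInf ρ (f t)).2 0 1 * ρ (f t) 1) / ρ (f t) 0 ^ 2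
          + ρ (f t) 3 - ρ (f t) 1 / ρ (f t) 0 * ρ (f t) 2)
          = g * (((jetInf σ t).2 1 1 * σ t 0 - (jetInf σ t).2 0 1 * σ t 1) / σ t 0 ^ 2
          + σ t 3 - σ t 1 / σ t 0 * σ t 2) := by
        field_simp
        linear_combination e6
      linear_combination e7 + σ t 1 / σ t 0 * hR

/-- The differences of ∇ⁱJ along σ and ρ, taken at corresponding points, form a chain under d/du up
to the factor 1/`nablaCoeff`. Their vanishing for i ≤ k therefore makes the perturbation of r and s
flat to order k. -/
theorem trunc_jetInf_adapted (hσ : ContDiff ℝ ∞ σ) (hρ : ContDiff ℝ ∞ ρ) (hU : IsOpen U)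
    (hf : ContDiffOn ℝ ∞ f U) (hV : IsOpen (f '' U))
    (hψ : ContDiffOn ℝ ∞ ψ (f '' U)) (hψf : ∀ t ∈ U, ψ (f t) = t)
    (rσ : ∀ t ∈ U, jetInf σ t ∈ Regular) (rρ : ∀ t ∈ U, jetInf ρ (f t) ∈ Regular)
    (hd : ∀ t ∈ U, deriv f t = nablaCoeff (jetInf ρ (f t)) / nablaCoeff (jetInf σ t))
    {x : ℝ} (hx : x ∈ U) {k : ℕ}
    (h : ∀ i ≤ k, nabla^[i] J (jetInf σ x) = nabla^[i] J (jetInf ρ (f x))) :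
    trunc k (jetInf (adapted σ ρ ψ) (f x)) = trunc k (jetInf ρ (f x)) := by
  have rρ' : ∀ u ∈ f '' U, jetInf ρ u ∈ Regular := by
    rintro _ ⟨t, ht, rfl⟩
    exact rρ t ht
  have hψm : Set.MapsTo ψ (f '' U) U := by
    rintro _ ⟨t, ht, rfl⟩
    rwa [hψf t ht]
  have hxV : f x ∈ f '' U := Set.mem_image_of_mem f hx
  have sρ (i : Fin 4) : ContDiff ℝ ∞ fun t => ρ t i := contDiff_pi.1 hρ i
  have sE (i : ℕ) : ContDiffOn ℝ ∞
      (fun u => nabla^[i] J (jetInf σ (ψ u)) - nabla^[i] J (jetInf ρ u)) (f '' U) :=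
    ((contDiffOn_along (isSmoothOfOrder_nabla_iterate_J i) hU hσ.contDiffOn rσ).comp hψ hψm).sub
      (contDiffOn_along (isSmoothOfOrder_nabla_iterate_J i) hV hρ.contDiffOn rρ')
  have sc : ContDiffOn ℝ ∞ (fun u => (nablaCoeff (jetInf ρ u))⁻¹) (f '' U) :=
    (contDiffOn_along isSmoothOfOrder_nablaCoeff hV hρ.contDiffOn rρ').inv
      fun u hu => (nablaCoeff_pos (rρ' u hu)).ne'
  have dE (i : ℕ) : ∀ u ∈ f '' U, HasDerivAt
      (fun u => nabla^[i] J (jetInf σ (ψ u)) - nabla^[i] J (jetInf ρ u))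
      ((nabla^[i + 1] J (jetInf σ (ψ u)) - nabla^[i + 1] J (jetInf ρ u))
        * (nablaCoeff (jetInf ρ u))⁻¹) u := by
    rintro _ ⟨t, ht, rfl⟩
    have hI := isSmoothOfOrder_nabla_iterate_J i
    have hA := nablaCoeff_pos (rσ t ht)
    have hA' := nablaCoeff_pos (rρ t ht)
    have dψ := ((hψ.contDiffAt (hV.mem_nhds (Set.mem_image_of_mem f ht))).differentiableAt
      (by simp)).hasDerivAt
    have df : HasDerivAt f (deriv f t) t :=
      ((hf.contDiffAt (hU.mem_nhds ht)).differentiableAt (by simp)).hasDerivAt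
    have e := (dψ.comp t df).unique ((hasDerivAt_id t).congr_of_eventuallyEq <| by
      filter_upwards [hU.mem_nhds ht] with s hs using hψf s hs)
    have e' : deriv ψ (f t) = nablaCoeff (jetInf σ t) / nablaCoeff (jetInf ρ (f t)) := by
      rw [hd t ht] at e
      field_simp at e ⊢
      exact e
    have d₁ := hasDerivAt_along hI hU hσ.contDiffOn ht (rσ t ht)
    rw [← hψf t ht] at d₁
    have d₂ := hasDerivAt_along hI hV hρ.contDiffOn (Set.mem_image_of_mem f ht) (rρ t ht)
    refine ((d₁.comp (f t) dψ).sub d₂).congr_deriv ?_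
    rw [e', Function.iterate_succ_apply', nabla, nabla, hψf t ht]
    field_simp
  have flat {n : ℕ} (hn : n ≤ k) {b : ℝ → ℝ} (hb : ContDiffOn ℝ ∞ b (f '' U)) :
      iteratedDeriv n (fun u => b u * (J (jetInf σ (ψ u)) - J (jetInf ρ u))) (f x) = 0 :=
    iteratedDeriv_mul_eq_zero hV hxV sc sE dE (k := k)
      (fun i hi => by rw [hψf x hx, h i hi, sub_self]) (i := 0) (by omega) hb
  have sb : ContDiffOn ℝ ∞ (fun u => -jCoeff (jetInf ρ u)) (f '' U) :=
    (contDiffOn_along isSmoothOfOrder_jCoeff hV hρ.contDiffOn rρ').neg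
  have perturb {n : ℕ} (hn : n ≤ k) (i : Fin 4) {b : ℝ → ℝ} (hb : ContDiffOn ℝ ∞ b (f '' U)) :
      iteratedDeriv n (fun u => ρ u i + b u * (J (jetInf σ (ψ u)) - J (jetInf ρ u))) (f x)
        = iteratedDeriv n (fun u => ρ u i) (f x) := by
    have hb' : ContDiffAt ℝ ∞ (fun u => b u * (J (jetInf σ (ψ u)) - J (jetInf ρ u))) (f x) :=
      (hb.mul (sE 0)).contDiffAt (hV.mem_nhds hxV)
    rw [iteratedDeriv_fun_add ((sρ i).contDiffAt.of_le (by exact_mod_cast le_top))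
      (hb'.of_le (by exact_mod_cast le_top)), flat hn hb, add_zero]
  ext i n
  · rfl
  · have hn := Nat.le_of_lt_succ n.2
    fin_cases i
    · rfl
    · rfl
    · exact perturb hn 2 sb
    · have sq : ContDiffOn ℝ ∞ (fun u => ρ u 1 / ρ u 0 * -jCoeff (jetInf ρ u)) (f '' U) :=
        (((sρ 1).contDiffOn.div (sρ 0).contDiffOn fun u hu => by
          simpa [L₀, jetInf] using (rρ' u hu).1).mul sb)
      have := perturb hn 3 sq
      simpa [trunc, jetInf, adapted, mul_assoc] using this

end Adapted

theorem sameOrbit_of_eq {k : ℕ} {z w : JInf} (hz : z ∈ Regular) (hw : w ∈ Regular)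
    (h₀ : 0 < L₀ z * L₀ w) (h₁ : 0 < L₁ z * L₁ w)
    (h : ∀ i ≤ k, nabla^[i] J z = nabla^[i] J w) : SameOrbit k (trunc k z) (trunc k w) := by
  -- Order k + 2 is what ∇ᵏJ sees.
  obtain ⟨σ, hσ, hσz⟩ := exists_section_of_jet (k + 2) z
  obtain ⟨ρ, hρ, hρw⟩ := exists_section_of_jet (k + 2) w
  have restrict {v v' : JInf} (e : trunc (k + 2) v = trunc (k + 2) v') {n : ℕ} (hn : n ≤ k + 2) :
      trunc n v = trunc n v' := by
    ext i m
    · have := congrArg Prod.fst e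
      exact this
    · exact coord_eq_of_trunc_eq e i (by omega)
  have rz : jetInf σ z.1 ∈ Regular := regular_of_trunc_eq (by omega) hσz.symm hz
  have rw' : jetInf ρ w.1 ∈ Regular := regular_of_trunc_eq (by omega) hρw.symm hw
  obtain ⟨U, f, ψ, hU, hx, hfx, hf, hinj, hV, hψ, H⟩ := exists_change_of_parameter hσ hρ rz rw'
    (by rwa [L₀_eq_of_trunc_eq hσz, L₀_eq_of_trunc_eq hρw])
    (by rwa [L₁_eq_of_trunc_eq (by omega) hσz, L₁_eq_of_trunc_eq (by omega) hρw])
  obtain ⟨g, h', hC⟩ := carries_adapted hσ hρ hU hf hinj hV hψ (fun t ht => (H t ht).1)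
    (fun t ht => (H t ht).2.1) (fun t ht => (H t ht).2.2.1) (fun t ht => (H t ht).2.2.2)
  refine ⟨U, f, g, h', σ, adapted σ ρ ψ, z.1, hC, hx, (restrict hσz (by omega)).symm, ?_⟩
  rw [jet, trunc_jetInf_adapted hσ hρ hU hf hV hψ (fun t ht => (H t ht).1)
    (fun t ht => ⟨left_ne_zero_of_mul (H t ht).2.1.ne', left_ne_zero_of_mul (H t ht).2.2.1.ne'⟩)
    (fun t ht => ⟨right_ne_zero_of_mul (H t ht).2.1.ne', right_ne_zero_of_mul (H t ht).2.2.1.ne'⟩)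
    (fun t ht => (H t ht).2.2.2) hx, hfx]
  · exact (restrict hρw (by omega)).symm
  · intro i hi
    rw [hfx, (isSmoothOfOrder_nabla_iterate_J i).eq_of_trunc_eq rz hz (restrict hσz (by omega)),
      (isSmoothOfOrder_nabla_iterate_J i).eq_of_trunc_eq rw' hw (restrict hρw (by omega)), h i hi]

theorem sameOrbit_of_invariants_eq {k : ℕ} {z w : JInf} (hz : z ∈ Regular) (hw : w ∈ Regular)
    (h₀ : 0 < L₀ z * L₀ w) (h₁ : 0 < L₁ z * L₁ w)
    (h : ∀ i < k - 1, nabla^[i] J z = nabla^[i] J w) : SameOrbit k (trunc k z) (trunc k w) := by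
  obtain ⟨w', hw', hk, h1, hi⟩ := exists_prolongation hw (fun i hik => (h i hik).symm) 2
  rw [← hk]
  refine sameOrbit_of_eq hz hw' ?_ ?_ fun i hik => (hi i (by omega)).symm
  · rwa [L₀_eq_of_trunc_eq hk]
  · rwa [L₁_eq_of_trunc_eq le_rfl h1]

theorem abs_signCast {a : SignType} (h : a ≠ 0) : |(a : ℝ)| = 1 := by
  cases a <;> simp_all

theorem signCast_ne {a : SignType} (h : a ≠ 0) : (a : ℝ) ≠ 0 :=
  abs_pos.1 (by rw [abs_signCast h]; exact one_pos)

end QuarticODE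

/-! ### Generation and separation -/

open QuarticODE
theorem theorem6 :
    -- the derivation is invariant, and `J` and its derivatives are differential invariants
    IsInvariantDerivation nablaCoeff ∧
    (∀ i : ℕ, IsDiffInvariant (i + 2) (nabla^[i] J)) ∧
    -- they generate: an invariant of order at most `k` is a smooth function of
    -- `J, ∇ J, …, ∇^(k-2) J`, for each choice of the (locally constant) signs of `L₀`, `L₁`
    (∀ (k : ℕ) (I : JInf → ℝ), IsDiffInvariant k I →
      ∃ Φ : SignType → SignType → (Fin (k - 1) → ℝ) → ℝ,
        (∀ a b, ContDiff ℝ ∞ (Φ a b)) ∧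
        ∀ z ∈ Regular,
          I z = Φ (SignType.sign (L₀ z)) (SignType.sign (L₁ z))
            (fun i => (nabla^[(i : ℕ)] J) z)) ∧
    -- the algebra of invariants separates regular orbits, in every order
    (∀ (k : ℕ), ∀ z ∈ Regular, ∀ w ∈ Regular,
      (∀ I : JInf → ℝ, IsDiffInvariant k I → I z = I w) →
        SameOrbit k (trunc k z) (trunc k w)) := by
  refine ⟨isInvariantDerivation_nablaCoeff, isDiffInvariant_nabla_iterate_J, ?_, ?_⟩
  · rintro k I ⟨⟨F, hF, hIF⟩, hI⟩
    -- Solves -4ab rₙ = cₙ using (ab)² = 1. The remaining entries are set to 0: they do not affect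
    -- the orbit of the k-jet. The truncated k - 1 is 0 for k ≤ 1, which makes the invariant
    -- constant on each sign component.
    let r (a b : ℝ) (c : Fin (k - 1) → ℝ) (n : ℕ) : ℝ :=
      if h : n < k - 1 then -(a * b) / 4 * c ⟨n, h⟩ else 0
    -- A zero sign never occurs at a regular point; the value 0 there only keeps Φ smooth.
    refine ⟨fun a b c => if a ≠ 0 ∧ b ≠ 0 then F (trunc k (normalJet a b 0 (r a b c))) else 0,
      fun a b => ?_, fun z hz => ?_⟩
    · by_cases hab : a ≠ 0 ∧ b ≠ 0
      · simp only [if_pos hab]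
        refine hF.comp_contDiff (f := fun c => trunc k (normalJet a b 0 (r a b c))) ?_ fun c =>
          trunc_mem (normalJet_mem ?_ ?_ _ _)
        · refine contDiff_const.prodMk (contDiff_pi.2 fun i => contDiff_pi.2 fun n => ?_)
          fin_cases i
          · exact contDiff_const
          · exact contDiff_const
          · change ContDiff ℝ ∞ fun c => r a b c n
            simp only [r]
            split_ifs
            · fun_prop
            · exact contDiff_const
          · exact contDiff_const
        · exact signCast_ne hab.1
        · exact signCast_ne hab.2
      · simp only [if_neg hab]
        exact contDiff_const
    · have hs₀ : SignType.sign (L₀ z) ≠ 0 := sign_ne_zero.2 hz.1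
      have hs₁ : SignType.sign (L₁ z) ≠ 0 := sign_ne_zero.2 hz.2
      set a := SignType.sign (L₀ z) with ha
      set b := SignType.sign (L₁ z) with hb
      have ha1 : |(a : ℝ)| = 1 := abs_signCast hs₀
      have hb1 : |(b : ℝ)| = 1 := abs_signCast hs₁
      have ha0 : (a : ℝ) ≠ 0 := signCast_ne hs₀
      have hb0 : (b : ℝ) ≠ 0 := signCast_ne hs₁
      have hab : ((a : ℝ) * b) ^ 2 = 1 := by rw [← sq_abs, abs_mul, ha1, hb1]; norm_num
      simp only [if_pos (And.intro hs₀ hs₁)]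
      have hn := normalJet_mem ha0 hb0 0 (r a b fun i => (nabla^[(i : ℕ)] J) z)
      rw [← hIF _ hn]
      refine hI z hz _ hn (sameOrbit_of_invariants_eq hz hn ?_ ?_ fun i hi => ?_)
      · rw [L₀_normalJet, ha, self_mul_sign]
        exact abs_pos.2 hz.1
      · rw [L₁_normalJet, hb, mul_left_comm, self_mul_sign]
        exact mul_pos (by positivity) (abs_pos.2 hz.2)
      · rw [nabla_iterate_J_normalJet ha1 hb1]
        simp only [r, dif_pos hi]
        linear_combination -(nabla^[i] J z) * hab
  · intro k z hz w hw h
    have h₀ := (sign_eq_iff_div_abs hz.1 hw.1).1 (h _ (isDiffInvariant_sign_L₀ k))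
    rcases Nat.eq_zero_or_pos k with rfl | hk
    · obtain ⟨w', hw', hk, h1⟩ := exists_L₁_eq hw hz.2
      rw [← hk]
      refine sameOrbit_of_invariants_eq hz hw' ?_ ?_ fun i hi => absurd hi (by omega)
      · rwa [L₀_eq_of_trunc_eq hk]
      · rw [h1]
        exact mul_self_pos.2 hz.2
    · refine sameOrbit_of_invariants_eq hz hw h₀
        ((sign_eq_iff_div_abs hz.2 hw.2).1 (h _ (isDiffInvariant_sign_L₁ hk))) fun i hi => h _ ?_
      refine (isCarriesInvariant_nabla_iterate_J i).isDiffInvariant hk ?_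
      exact (isSmoothOfOrder_nabla_iterate_J i).mono (by omega)
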